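/- All digraphs are oriented simple graphs (no loops, no antiparallel arcs). A \emph{tournament} is a digraph in which exactly one of $uv$, $vu$ is an arc for all distinct vertices $u,v$. Throughout, $\kappa$ is an infinite cardinal. A tournament $D$ is \emph{$\kappa$-uniform} if $|N^+(v)\,\Delta\, N^+(v')|<\kappa$ and $|N^-(v)\,\Delta\, N^-(v')|<\kappa$ for all vertices $v,v'$ of $D$, where $N^+(v)$ and $N^-(v)$ are the sets of out-neighbours and in-neighbours of $v$. A \emph{strong component} of a digraph is a maximal induced subdigraph in which any two distinct vertices are joined by directed paths in both directions. The set $\mathrm{rs}(D)$ of \emph{reversal sequences} of $D$ consists of the transfinite sequences $\mathcal C=\langle C_\xi\rangle_{\xi<\alpha}$ ($\alpha$ an ordinal) such that each arc lies in only finitely many of the $C_\xi$, and each $C_\xi$ is a directed cycle in the digraph $D_\xi$, where $D_0=D$, $D_{\xi+1}$ is obtained from $D_\xi$ by reversing all arcs of $C_\xi$, and for limit $\xi$ the digraph $D_\xi$ is the limit of $\langle D_\zeta\rangle_{\zeta<\xi}$ (its arcs are those which belong to $D_\zeta$ for all large enough $\zeta<\xi$). The result $D_\alpha$ is denoted by $D^{\mathcal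 C}$. Let $D$ be a tournament with vertex set $V$ of size $\kappa$. (A) If $D$ is $\kappa$-uniform, then there are $\mathcal C\in \mathrm{rs}(D)$ and $V^+,V^-$ with $V=V^+\cup V^-$ such that (1) every vertex of the subdigraph of $D^{\mathcal C}$ induced on $V^+$ has in-degree $<\kappa$ in it, (2) every vertex of the subdigraph of $D^{\mathcal C}$ induced on $V^-$ has out-degree $<\kappa$ in it, and (3) each strong component of $D^{\mathcal C}$ is contained either in $V^+$ or in $V^-$. (B) If $D$ is $\kappa$-uniform, then there is $\mathcal C\in \mathrm{rs}(D)$ such that all strong components of $D^{\mathcal C}$ have size $<\kappa$. (C) Without the assumption of $\kappa$-uniformity, there is $\mathcal C\in \mathrm{rs}(D)$ such that all strong components of $D^{\mathcal C}$ have size $<\kappa$. -/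

import Mathlib

open Cardinal

universe u

namespace CycleReversal

variable {V : Type u}

/-- A tournament: a loopless digraph in which exactly one of `uv`, `vu` is an arc for any two
distinct vertices `u`, `v`. -/
def IsTournament (D : Digraph V) : Prop :=
  (∀ v, ¬ D.Adj v v) ∧ ∀ u v, u ≠ v → Xor (D.Adj u v) (D.Adj v u)

/-- The set of out-neighbours `N⁺(v)`. -/
def outNbhd (D : Digraph V) (v : V) : Set V := {w | D.Adj v w}

/-- The set of in-neighbours `N⁻(v)`. -/
def inNbhd (D : Digraph V) (v : V) : Set V := {w | D.Adj w v}

/-- The subdigraph of `D` induced on a set of vertices. -/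
def induced (D : Digraph V) (S : Set V) : Digraph S := ⟨fun a b => D.Adj a b⟩

/-- `κ`-uniformity: any two vertices have the same out-neighbours, and the same in-neighbours,
up to fewer than `κ` vertices. -/
def IsUniform (κ : Cardinal.{u}) (D : Digraph V) : Prop :=
  ∀ v v' : V, #(symmDiff (outNbhd D v) (outNbhd D v') : Set V) < κ ∧
    #(symmDiff (inNbhd D v) (inNbhd D v') : Set V) < κ

/-- A digraph is strong if any two distinct vertices are joined by a directed path in both
directions (`Relation.TransGen D.Adj a b` says that there is a nontrivial directed walk from `a`
to `b`, which for `a ≠ b` is the same as a directed path). -/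
def IsStrong (D : Digraph V) : Prop :=
  ∀ a b : V, a ≠ b → Relation.TransGen D.Adj a b

/-- `S` is the vertex set of a strong component, i.e. of a maximal strong induced subdigraph. -/
def IsStrongComponent (D : Digraph V) (S : Set V) : Prop :=
  Maximal (fun T : Set V => IsStrong (induced D T)) S

/-- `C` is (the arc set of) a directed cycle in `D`. In an oriented simple graph every directed
cycle has at least three vertices; `Fin (n + 3)` is used cyclically, so that `i + 1 = 0` for the
last `i`. -/
def IsDirectedCycle (D C : Digraph V) : Prop :=
  (∃ (n : ℕ) (x : Fin (n + 3) → V), Function.Injective x ∧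
    ∀ a b, C.Adj a b ↔ ∃ i, x i = a ∧ x (i + 1) = b) ∧
  ∀ a b, C.Adj a b → D.Adj a b

/-- The digraph obtained from `D` by reversing all the arcs of its subdigraph `C`. -/
def reverse (D C : Digraph V) : Digraph V :=
  ⟨fun a b => (D.Adj a b ∧ ¬ C.Adj a b) ∨ C.Adj b a⟩

/-- A transfinite sequence of digraphs on `V`, of ordinal length. Only the values of `term` at
ordinals below `length` are relevant. -/
structure CycleSeq (V : Type u) where
  length : Ordinal.{u}
  term : Ordinal.{u} → Digraph V

/-- The digraph obtained from `D` after the terms of `C` with index less than `ξ` were reversed,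
one after the other, with pointwise limits at limit steps. -/
noncomputable def stage (D : Digraph V) (C : CycleSeq V) (ξ : Ordinal.{u}) : Digraph V :=
  Ordinal.limitRecOn ξ D (fun η E => reverse E (C.term η))
    (fun ζ _ E => ⟨fun a b => ∃ η < ζ, ∀ (θ : Ordinal.{u}) (hθ : θ < ζ), η ≤ θ → (E θ hθ).Adj a b⟩)

/-- The set `rs(D)` of reversal sequences of `D`: every term is a directed cycle in the digraph
reached at that point, and each arc lies in only finitely many terms. -/
def rs (D : Digraph V) : Set (CycleSeq V) :=
  {C | (∀ ξ < C.length, IsDirectedCycle (stage D C ξ) (C.term ξ)) ∧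
    ∀ a b, {ξ | ξ < C.length ∧ (C.term ξ).Adj a b}.Finite}

/-- The digraph that results from `D` by reversing the whole sequence `C`. -/
noncomputable def rev (D : Digraph V) (C : CycleSeq V) : Digraph V := stage D C C.length

theorem stage_zero (D : Digraph V) (C : CycleSeq V) : stage D C 0 = D := by
  simp [stage]

theorem stage_add_one (D : Digraph V) (C : CycleSeq V) (ξ : Ordinal.{u}) :
    stage D C (ξ + 1) = reverse (stage D C ξ) (C.term ξ) := by
  simp [stage]

theorem stage_limit (D : Digraph V) (C : CycleSeq V) {ξ : Ordinal.{u}} (hξ : Order.IsSuccLimit ξ)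
    (a b : V) :
    (stage D C ξ).Adj a b ↔ ∃ η < ξ, ∀ θ < ξ, η ≤ θ → (stage D C θ).Adj a b := by
  unfold stage
  rw [Ordinal.limitRecOn_limit _ _ _ _ hξ]

end CycleReversal

open CycleReversal

/-!
The statement is reduced to finding a function `f : V → V → ZMod 2` that tells which pairs of vertices
have their arc turned around by a reversal sequence. Since each pair is touched finitely often, the
stage reached after any initial part of the sequence is determined by the parity of the number of
earlier cycles through each pair. `Achieves D T f` says that `f` arises from a well-ordered family of
cycles touching only pairs in `T`; `Achieves.exists_mem_rs` turns such a family into an element of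
`rs D`, and `Achieves.concat` permits to carry out well-ordered families of reversal sequences one
after the other as long as every pair is touched by finitely many of them.

The main tool is that an arc `uv` can be reversed alone if there are infinitely many disjoint paths
`P₀, P₁, …` from `v` to `u`: reverse the cycle `uv ∪ P₀`, then the cycle formed by `P₁` and the
reversed `P₀`, and so on; in the limit all paths are restored. Given a set of arcs, such paths are
chosen for all of them disjointly by transfinite recursion, which succeeds if the arcs can be
enumerated so that each one has more paths than predecessors (`achieves_pairsInd`). Paths of length
two and three suffice.

Let `D` be `κ`-uniform. For `A = N⁺(v₀)`, every vertex has fewer than `κ` in-neighbours in `A` and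
fewer than `κ` out-neighbours in `Aᶜ` (`IsSplit`). If there are `κ` disjoint arcs from `A` to `Aᶜ`,
they provide paths of length three with which all arcs from `A` to `Aᶜ` can be reversed; hence these
arcs can be assumed to be covered by a set `W` of fewer than `κ` vertices (`exists_achieves_cover`).
Call a set closed if it contains the in-neighbours in `A` and the out-neighbours in `Aᶜ` of its
elements. If every vertex lies in a closed set of size `< κ`, and some closed set `L` of size `< κ`
covers the arcs from `A` to `Aᶜ`, then `A ∪ L` and its complement are as required in (A), and all
strong components have size `< κ` (`isGood_of_isSplitClosed`). Such closed sets are obtained as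
follows.

* If `κ` is a successor, the closure of a set of size `< κ` has size `< κ`.
* If `κ = ℵ₀`, it suffices to treat countable tournaments with finite in-degrees, and to make every
  vertex reachable from finitely many vertices only. If `v` is reachable from infinitely many
  vertices, then by Kőnig's lemma there is a path `… → x₂ → x₁ → x₀ = v` with `x₀ → xₙ` for `n ≥ 2`; it
  can be reversed by triangles, and this decreases the in-degree of `v`
  (`exists_achieves_inClosed_finite`).
* If `κ` is an uncountable limit cardinal, let `a v` and `b v` be the numbers of in-neighbours of `v`
  in `A` and of its out-neighbours in `Aᶜ`, rounded up to a cardinal `l ≥ #W`. All arcs `wv` with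
  `w ∈ A` and `a v < a w` are reversed, by means of the `a w` paths of length two from `v` to `w`, and
  dually in `Aᶜ`. Then the sets `{v | a v ≤ μ ∧ b v ≤ μ}` are closed, and they have size at most
  `μ⁺ < κ`, as in a tournament at most `μ⁺` vertices have in-degree at most `μ`
  (`exists_isGood_of_balanced`).

For (C), order the vertices by inclusion of out-neighbourhoods up to fewer than `κ` elements, extended
to a linear order of the classes. From `v` to a vertex `u` of a smaller class there are `κ` paths of
length two, so all arcs leading to a larger class can be reversed. Afterwards, every strong
component lies in one class. Each class has size `< κ` or induces a `κ`-uniform tournament, and the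
uniform case is applied in all classes.
-/

namespace CycleReversal

/-! ### Exchanging pairs in a digraph -/

open scoped Classical in
/-- The digraph obtained from `D` by exchanging `D.Adj a b` and `D.Adj b a` for all pairs with
`f a b = 1`. Reversals are composed by adding the functions `f`, which are always symmetric. -/
def swapBy {V : Type*} (D : Digraph V) (f : V → V → ZMod 2) : Digraph V :=
  ⟨fun a b => if f a b = 0 then D.Adj a b else D.Adj b a⟩

open scoped Classical in
/-- The indicator function of the unordered pair `{x, y}`. -/
noncomputable def pairInd {V : Type*} (x y : V) : V → V → ZMod 2 :=
  fun a b => if (a = x ∧ b = y) ∨ (a = y ∧ b = x) then 1 else 0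

open scoped Classical in
/-- The indicator function of the unordered pairs joined by an arc of `C`. -/
noncomputable def touch {V : Type*} (C : Digraph V) : V → V → ZMod 2 :=
  fun a b => if C.Adj a b ∨ C.Adj b a then 1 else 0

theorem zmod_two_cases (x : ZMod 2) : x = 0 ∨ x = 1 := by
  revert x; decide

theorem zmod_two_add_self (x : ZMod 2) : x + x = 0 := by
  revert x; decide

section basic

variable {V : Type*}

theorem swapBy_adj_zero {D : Digraph V} {f : V → V → ZMod 2} {a b : V} (h : f a b = 0) :
    (swapBy D f).Adj a b ↔ D.Adj a b := by
  simp [swapBy, h]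

theorem swapBy_adj_one {D : Digraph V} {f : V → V → ZMod 2} {a b : V} (h : f a b ≠ 0) :
    (swapBy D f).Adj a b ↔ D.Adj b a := by
  simp [swapBy, h]

theorem swapBy_adj_congr {D : Digraph V} {f g : V → V → ZMod 2} {a b : V} (h : f a b = g a b) :
    (swapBy D f).Adj a b ↔ (swapBy D g).Adj a b := by
  simp [swapBy, h]

@[simp] theorem swapBy_zero (D : Digraph V) : swapBy D (fun _ _ => 0) = D := by
  ext a b; simp [swapBy]

@[simp] theorem swapBy_zero' (D : Digraph V) : swapBy D 0 = D := by
  ext a b; simp [swapBy]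

theorem swapBy_swapBy (D : Digraph V) {f g : V → V → ZMod 2} (hf : ∀ a b, f a b = f b a) :
    swapBy (swapBy D f) g = swapBy D (f + g) := by
  ext a b
  have := hf a b
  rcases zmod_two_cases (f a b) with h | h <;> rcases zmod_two_cases (g a b) with h' | h' <;>
    simp [swapBy, h, h', ← this, zmod_two_add_self]

theorem touch_symm (C : Digraph V) (a b : V) : touch C a b = touch C b a := by
  classical
  unfold touch
  exact if_congr or_comm rfl rfl

theorem touch_ne_zero {C : Digraph V} {a b : V} :
    touch C a b ≠ 0 ↔ C.Adj a b ∨ C.Adj b a := by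
  unfold touch
  split_ifs with h <;> simp [h]

theorem pairInd_symm (x y a b : V) : pairInd x y a b = pairInd x y b a := by
  have : ((a = x ∧ b = y) ∨ (a = y ∧ b = x)) ↔ ((b = x ∧ a = y) ∨ (b = y ∧ a = x)) := by tauto
  classical
  unfold pairInd
  exact if_congr this rfl rfl

theorem pairInd_comm (x y : V) : pairInd x y = pairInd y x := by
  funext a b
  have : ((a = x ∧ b = y) ∨ (a = y ∧ b = x)) ↔ ((a = y ∧ b = x) ∨ (a = x ∧ b = y)) := by tauto
  classical
  unfold pairInd
  exact if_congr this rfl rfl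

theorem pairInd_ne_zero {x y a b : V} :
    pairInd x y a b ≠ 0 ↔ (a = x ∧ b = y) ∨ (a = y ∧ b = x) := by
  unfold pairInd
  split_ifs with h <;> simp [h]

theorem pairInd_eq_zero {x y a b : V} (h : ¬ ((a = x ∧ b = y) ∨ (a = y ∧ b = x))) :
    pairInd x y a b = 0 := by
  simp [pairInd, h]

theorem IsTournament.asymm {D : Digraph V} (hD : IsTournament D) {a b : V} (h : D.Adj a b) :
    ¬ D.Adj b a := by
  intro h'
  have hne : a ≠ b := by rintro rfl; exact hD.1 _ h
  rcases hD.2 a b hne with h1 | h1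
  · exact h1.2 h'
  · exact h1.2 h

theorem IsTournament.ne {D : Digraph V} (hD : IsTournament D) {a b : V} (h : D.Adj a b) :
    a ≠ b := by
  rintro rfl; exact hD.1 _ h

theorem IsTournament.adj_of_not {D : Digraph V} (hD : IsTournament D) {a b : V} (hne : a ≠ b)
    (h : ¬ D.Adj a b) : D.Adj b a := by
  rcases hD.2 a b hne with h1 | h1
  · exact absurd h1.1 h
  · exact h1.1

theorem IsTournament.swapBy {D : Digraph V} (hD : IsTournament D) {f : V → V → ZMod 2}
    (hf : ∀ a b, f a b = f b a) : IsTournament (swapBy D f) := by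
  refine ⟨fun v => ?_, fun a b hab => ?_⟩
  · have := hD.1 v
    simp [CycleReversal.swapBy, this]
  · have h1 := hD.2 a b hab
    have h2 := hf a b
    rcases zmod_two_cases (f a b) with h | h
    · simpa [CycleReversal.swapBy, h, ← h2] using h1
    · simpa [CycleReversal.swapBy, h, ← h2] using (xor_comm _ _).mp h1

/-- In a tournament, reversing the arcs of `C` exchanges the pairs that are joined by `C`. -/
theorem reverse_swapBy {D : Digraph V} (hD : IsTournament D) {f : V → V → ZMod 2}
    (hf : ∀ a b, f a b = f b a) {C : Digraph V}
    (hC : ∀ a b, C.Adj a b → (swapBy D f).Adj a b) :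
    reverse (swapBy D f) C = swapBy D (f + touch C) := by
  rw [← swapBy_swapBy D hf]
  have hE := hD.swapBy hf
  generalize CycleReversal.swapBy D f = E at hC hE
  ext a b
  by_cases h1 : C.Adj a b
  · have h3 : touch C a b ≠ 0 := touch_ne_zero.2 (Or.inl h1)
    have h4 : ¬ C.Adj b a := fun h => hE.asymm (hC _ _ h1) (hC _ _ h)
    rw [swapBy_adj_one h3]
    simp [reverse, h1, h4, hE.asymm (hC _ _ h1)]
  · by_cases h2 : C.Adj b a
    · have h3 : touch C a b ≠ 0 := touch_ne_zero.2 (Or.inr h2)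
      rw [swapBy_adj_one h3]
      simp [reverse, h2, hC _ _ h2]
    · have h3 : touch C a b = 0 := by simp [touch, h1, h2]
      rw [swapBy_adj_zero h3]
      simp [reverse, h1, h2]

end basic

/-! ### Reversal sequences indexed by well-orders -/

open scoped Classical in
/-- Some reversal sequence of `D`, indexed by a well-order, touches only pairs in the relation `T`
and reverses in total exactly the pairs with `f a b = 1`. The digraph before the `i`-th reversal is
given explicitly, by the number modulo two of earlier cycles through each pair. -/
def Achieves {V : Type u} (D : Digraph V) (T : V → V → Prop) (f : V → V → ZMod 2) : Prop :=
  ∃ (I : Type u) (r : I → I → Prop) (_ : IsWellOrder I r) (C : I → Digraph V),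
    (∀ a b i, touch (C i) a b ≠ 0 → T a b) ∧
    (∀ a b, {i | touch (C i) a b ≠ 0}.Finite) ∧
    (∀ i, IsDirectedCycle
      (swapBy D (fun a b => ∑ᶠ k, if r k i then touch (C k) a b else 0)) (C i)) ∧
    f = fun a b => ∑ᶠ k, touch (C k) a b

theorem Achieves.symm {V : Type u} {D : Digraph V} {T : V → V → Prop} {f : V → V → ZMod 2}
    (h : Achieves D T f) (a b : V) : f a b = f b a := by
  obtain ⟨I, r, _, C, -, -, -, rfl⟩ := h
  simp only [touch_symm _ a b]

theorem Achieves.mono {V : Type u} {D : Digraph V} {T T' : V → V → Prop} {f : V → V → ZMod 2}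
    (h : Achieves D T f) (hT : ∀ a b, T a b → T' a b) : Achieves D T' f := by
  obtain ⟨I, r, w, C, h1, h2⟩ := h
  exact ⟨I, r, w, C, fun a b i h => hT _ _ (h1 a b i h), h2⟩

theorem Achieves.ne_zero {V : Type u} {D : Digraph V} {T : V → V → Prop} {f : V → V → ZMod 2}
    (h : Achieves D T f) {a b : V} (hf : f a b ≠ 0) : T a b := by
  obtain ⟨I, r, w, C, h1, -, -, rfl⟩ := h
  by_contra hT
  refine hf (finsum_eq_zero_of_forall_eq_zero fun k => ?_)
  by_contra hk
  exact hT (h1 a b k hk)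

theorem achieves_zero {V : Type u} (D : Digraph V) (T : V → V → Prop) :
    Achieves D T 0 := by
  refine ⟨PEmpty, fun _ _ => False, ?_, fun i => i.elim, ?_, ?_, ?_, ?_⟩
  · exact inferInstanceAs (IsWellOrder PEmpty emptyRelation)
  · intro _ _ i; exact i.elim
  · intro a b; exact Set.toFinite _
  · intro i; exact i.elim
  · funext a b; exact (finsum_of_isEmpty _).symm

section realize

open Ordinal

/-- A well-ordered family of cycles, indexed by ordinals, is a reversal sequence. The stage `ξ` is
`swapBy D (F ξ)`, where `F ξ` counts modulo two the cycles of index less than `ξ` through a pair. -/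
theorem Achieves.exists_mem_rs {V : Type u} {D : Digraph V} (hD : IsTournament D)
    {T : V → V → Prop} {f : V → V → ZMod 2} (h : Achieves D T f) :
    ∃ C ∈ rs D, rev D C = swapBy D f := by
  classical
  obtain ⟨I, r, w, C, -, hfin, hcyc, rfl⟩ := h
  let S : CycleSeq V :=
    ⟨type r, fun ξ => if h : ξ < type r then C (enum r ⟨ξ, h⟩) else ⟨fun _ _ => False⟩⟩
  let F : Ordinal → V → V → ZMod 2 :=
    fun ξ a b => ∑ᶠ k, if typein r k < ξ then touch (C k) a b else 0
  have hFsymm : ∀ ξ a b, F ξ a b = F ξ b a := fun ξ a b => by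
    simp only [F, touch_symm _ a b]
  have hFr : ∀ i, F (typein r i) = fun a b => ∑ᶠ k, if r k i then touch (C k) a b else 0 := by
    intro i; funext a b; simp only [F, typein_lt_typein]
  have key : ∀ ξ, ξ ≤ type r → stage D S ξ = swapBy D (F ξ) := by
    intro ξ
    induction ξ using Ordinal.limitRecOn with
    | zero =>
      intro _
      rw [stage_zero]
      have : F 0 = 0 := by
        funext a b
        simp [F]
      rw [this, swapBy_zero']
    | add_one ξ ih =>
      intro hξ
      have hlt : ξ < type r := lt_of_lt_of_le (lt_add_one ξ) hξ
      rw [stage_add_one, ih hlt.le]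
      have hterm : S.term ξ = C (enum r ⟨ξ, hlt⟩) := by simp [S, hlt]
      rw [hterm]
      have hc := hcyc (enum r ⟨ξ, hlt⟩)
      rw [← hFr, typein_enum] at hc
      rw [reverse_swapBy hD (hFsymm ξ) hc.2]
      congr 1
      funext a b
      have hsplit : ∀ k, (if typein r k < ξ + 1 then touch (C k) a b else 0) =
          (if typein r k < ξ then touch (C k) a b else 0) +
            (if k = enum r ⟨ξ, hlt⟩ then touch (C k) a b else 0) := by
        intro k
        by_cases hk : k = enum r ⟨ξ, hlt⟩
        · subst hk
          simp [typein_enum]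
        · have hne : typein r k ≠ ξ := by
            intro h; apply hk; rw [← typein_inj r, typein_enum, h]
          have : typein r k < ξ + 1 ↔ typein r k < ξ := by
            rw [← Order.succ_eq_add_one, Order.lt_succ_iff]
            exact ⟨fun h => lt_of_le_of_ne h hne, le_of_lt⟩
          simp [hk, this]
      simp only [F, Pi.add_apply, hsplit]
      rw [finsum_add_distrib]
      · congr 1
        rw [finsum_eq_single _ (enum r ⟨ξ, hlt⟩) (fun k hk => by simp [hk])]
        simp
      · refine (hfin a b).subset fun k hk => ?_
        simp only [Function.mem_support, ne_eq, ite_eq_right_iff, not_forall] at hk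
        exact hk.2
      · refine (hfin a b).subset fun k hk => ?_
        simp only [Function.mem_support, ne_eq, ite_eq_right_iff, not_forall] at hk
        exact hk.2
    | limit ξ hlim ih =>
      intro hξ
      ext a b
      rw [stage_limit D S hlim]
      -- below `ξ`, the pair `a, b` is not touched any more from some point on
      obtain ⟨η, hη, hη'⟩ : ∃ η < ξ, ∀ θ < ξ, η ≤ θ → F θ a b = F ξ a b := by
        have hfinS : {k | touch (C k) a b ≠ 0 ∧ typein r k < ξ}.Finite :=
          (hfin a b).subset fun k hk => hk.1
        have : ∃ η < ξ, ∀ k ∈ hfinS.toFinset, typein r k < η := by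
          have aux : ∀ s : Finset I, (∀ k ∈ s, typein r k < ξ) →
              ∃ η < ξ, ∀ k ∈ s, typein r k < η := by
            intro s
            refine Finset.induction_on s ?_ ?_
            · intro _
              exact ⟨0, hlim.bot_lt, by simp⟩
            · intro k s _ ihs hs
              obtain ⟨η, hη, h⟩ := ihs fun k hk => hs k (Finset.mem_insert_of_mem hk)
              refine ⟨max η (Order.succ (typein r k)),
                max_lt hη (hlim.succ_lt (hs k (Finset.mem_insert_self _ _))), ?_⟩
              intro k' hk'
              rcases Finset.mem_insert.1 hk' with rfl | hk'
              · exact lt_max_of_lt_right (Order.lt_succ _)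
              · exact lt_max_of_lt_left (h _ hk')
          refine aux _ fun k hk => ?_
          exact ((Set.Finite.mem_toFinset _).1 hk).2
        obtain ⟨η, hη, h⟩ := this
        refine ⟨η, hη, fun θ hθ hηθ => ?_⟩
        simp only [F]
        refine finsum_congr fun k => ?_
        by_cases ht : touch (C k) a b = 0
        · simp [ht]
        · by_cases hk : typein r k < ξ
          · have := h k (hfinS.mem_toFinset.2 ⟨ht, hk⟩)
            simp [hk, lt_of_lt_of_le this hηθ]
          · have hk2 : ¬ typein r k < θ := fun h => hk (h.trans hθ)
            simp only [hk, hk2]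
      constructor
      · rintro ⟨η', h1, h2⟩
        have h3 := h2 (max η η') (max_lt hη h1) (le_max_right _ _)
        rw [ih _ (max_lt hη h1) ((max_lt hη h1).le.trans hξ)] at h3
        exact (swapBy_adj_congr (hη' _ (max_lt hη h1) (le_max_left _ _))).1 h3
      · intro h
        refine ⟨η, hη, fun θ hθ hηθ => ?_⟩
        rw [ih θ hθ (hθ.le.trans hξ)]
        exact (swapBy_adj_congr (hη' θ hθ hηθ)).2 h
  refine ⟨S, ⟨?_, ?_⟩, ?_⟩
  · intro ξ hξ
    have hξ' : ξ < type r := hξ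
    rw [key ξ hξ'.le]
    have hc := hcyc (enum r ⟨ξ, hξ'⟩)
    rw [← hFr, typein_enum] at hc
    simpa [S, hξ'] using hc
  · intro a b
    refine ((hfin a b).image (typein r)).subset ?_
    rintro ξ ⟨hξ, h⟩
    have hξ' : ξ < type r := hξ
    refine ⟨enum r ⟨ξ, hξ'⟩, ?_, typein_enum r hξ'⟩
    have : (C (enum r ⟨ξ, hξ'⟩)).Adj a b := by simpa [S, hξ'] using h
    exact touch_ne_zero.2 (Or.inl this)
  · rw [rev, key _ le_rfl]
    congr 1
    funext a b
    simp only [F, typein_lt_type, if_true]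

end realize

/-! ### Concatenation of reversal sequences -/

theorem finsum_sigma_of_finite {J : Type*} {I : J → Type*} (φ : (Σ j, I j) → ZMod 2)
    (h : (Function.support φ).Finite) : ∑ᶠ x, φ x = ∑ᶠ j, ∑ᶠ i, φ ⟨j, i⟩ := by
  classical
  let t : Finset J := h.toFinset.image Sigma.fst
  have hinj : ∀ j, Function.Injective (fun i : I j => (⟨j, i⟩ : Σ j, I j)) :=
    fun j => sigma_mk_injective
  have hj : ∀ j, (Function.support fun i => φ ⟨j, i⟩).Finite := fun j =>
    Set.Finite.preimage (hinj j).injOn h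
  let u : ∀ j, Finset (I j) := fun j => (hj j).toFinset
  rw [finsum_eq_sum_of_support_subset (s := t.sigma u), Finset.sum_sigma,
    finsum_eq_sum_of_support_subset (s := t)]
  · refine Finset.sum_congr rfl fun j _ => ?_
    rw [finsum_eq_sum_of_support_subset]
    simp [u]
  · intro j hj'
    by_contra hjt
    refine hj' (finsum_eq_zero_of_forall_eq_zero fun i => ?_)
    by_contra hi
    exact hjt (Finset.mem_coe.2 (Finset.mem_image.2 ⟨⟨j, i⟩, by simpa using hi, rfl⟩))
  · rintro ⟨j, i⟩ hx
    have : φ ⟨j, i⟩ ≠ 0 := hx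
    simp only [Finset.coe_sigma, Set.mem_sigma_iff, Finset.mem_coe, t, u, Finset.mem_image,
      Set.Finite.mem_toFinset, Function.mem_support]
    exact ⟨⟨⟨j, i⟩, this, rfl⟩, this⟩

theorem isWellOrder_sigmaLex {J : Type*} {I : J → Type*} (s : J → J → Prop) [IsWellOrder J s]
    (r : ∀ j, I j → I j → Prop) [∀ j, IsWellOrder (I j) (r j)] :
    IsWellOrder (Σ j, I j) (Sigma.Lex s r) where
  wf := by
    have h : WellFounded (PSigma.Lex s r) :=
      ⟨fun ⟨a, b⟩ => PSigma.lexAccessible (IsWellFounded.wf.apply a)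
        (fun j => IsWellFounded.wf (r := r j)) b⟩
    refine Subrelation.wf ?_ (InvImage.wf (fun x : Σ j, I j => (⟨x.1, x.2⟩ : Σ' j, I j)) h)
    rintro ⟨j, i⟩ ⟨j', i'⟩ h
    cases h with
    | left _ _ h => exact PSigma.Lex.left _ _ h
    | right _ _ h => exact PSigma.Lex.right _ h
  trichotomous := by
    rintro ⟨j, i⟩ ⟨j', i'⟩ h1 h2
    rcases trichotomous_of s j j' with h | h | h
    · exact absurd (Sigma.Lex.left _ _ h) h1
    · subst h
      rcases trichotomous_of (r j) i i' with h | h | h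
      · exact absurd (Sigma.Lex.right _ _ h) h1
      · rw [h]
      · exact absurd (Sigma.Lex.right _ _ h) h2
    · exact absurd (Sigma.Lex.left _ _ h) h2

open scoped Classical in
/-- A well-ordered family of reversal sequences can be carried out one after the other, provided
that each pair is touched by finitely many of them only. -/
theorem Achieves.concat {V : Type u} {J : Type u} (s : J → J → Prop) [IsWellOrder J s]
    {D : Digraph V} {T : J → V → V → Prop} {f : J → V → V → ZMod 2}
    (h : ∀ j, Achieves (swapBy D (fun a b => ∑ᶠ k, if s k j then f k a b else 0)) (T j) (f j))
    (hT : ∀ a b, {j | T j a b}.Finite) :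
    Achieves D (fun a b => ∃ j, T j a b) (fun a b => ∑ᶠ j, f j a b) := by
  have hsymm : ∀ j a b, f j a b = f j b a := fun j => (h j).symm
  have hTf : ∀ j a b, f j a b ≠ 0 → T j a b := fun j a b => (h j).ne_zero
  choose I r w C h1 h2 h3 h4 using h
  have hfin : ∀ a b, {i : Σ j, I j | touch (C i.1 i.2) a b ≠ 0}.Finite := by
    intro a b
    have : {i : Σ j, I j | touch (C i.1 i.2) a b ≠ 0} ⊆
        ⋃ j ∈ {j | T j a b}, (fun i : I j => (⟨j, i⟩ : Σ j, I j)) '' {i | touch (C j i) a b ≠ 0} := by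
      rintro ⟨j, i⟩ hi
      simp only [Set.mem_iUnion]
      exact ⟨j, h1 j a b i hi, i, hi, rfl⟩
    exact ((hT a b).biUnion fun j _ => (h2 j a b).image _).subset this
  refine ⟨Σ j, I j, Sigma.Lex s r, isWellOrder_sigmaLex s r, fun x => C x.1 x.2, ?_, hfin, ?_, ?_⟩
  · rintro a b ⟨j, i⟩ hi
    exact ⟨j, h1 j a b i hi⟩
  · rintro ⟨j, i⟩
    have := h3 j i
    rw [swapBy_swapBy] at this
    · convert this using 2
      funext a b
      simp only [Pi.add_apply]
      rw [finsum_sigma_of_finite]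
      · have : ∀ j', (∑ᶠ i', if Sigma.Lex s r ⟨j', i'⟩ ⟨j, i⟩ then touch (C j' i') a b else 0) =
            (if s j' j then f j' a b else 0) +
            (if j' = j then ∑ᶠ k, (if r j k i then touch (C j k) a b else 0) else 0) := by
          intro j'
          by_cases hjj : j' = j
          · subst hjj
            simp [Sigma.lex_iff, irrefl_of s]
          · by_cases hs : s j' j
            · simp [Sigma.lex_iff, hs, hjj, h4 j']
            · simp [Sigma.lex_iff, hs, hjj]
        simp only [this]
        rw [finsum_add_distrib]
        · congr 1
          rw [finsum_eq_single _ j (fun k hk => by simp [hk])]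
          simp
        · refine (hT a b).subset fun k hk => ?_
          simp only [Function.mem_support, ne_eq, ite_eq_right_iff, not_forall] at hk
          exact hTf k a b hk.2
        · refine (Set.finite_singleton j).subset fun k hk => ?_
          simp only [Function.mem_support, ne_eq, ite_eq_right_iff, not_forall] at hk
          exact hk.1
      · refine (hfin a b).subset fun k hk => ?_
        simp only [Function.mem_support, ne_eq, ite_eq_right_iff, not_forall] at hk
        exact hk.2
    · intro a b
      simp only [hsymm _ a b]
  · funext a b
    rw [finsum_sigma_of_finite _ (hfin a b)]
    simp only [h4]

/-- Sequences of reversal sequences of order type `ω`, described by the pairs `S n` reversed before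
the `n`-th of them. -/
theorem Achieves.concat_nat {V : Type u} {D : Digraph V} {T : ℕ → V → V → Prop}
    (S : ℕ → V → V → ZMod 2) (S' : V → V → ZMod 2) (hS : S 0 = 0)
    (h : ∀ n, Achieves (swapBy D (S n)) (T n) (S (n + 1) + S n))
    (hT : ∀ a b, {n | T n a b}.Finite)
    (hS' : ∀ a b, ∃ N, ∀ n, N ≤ n → S n a b = S' a b) :
    Achieves D (fun a b => ∃ n, T n a b) S' := by
  classical
  have hsum : ∀ n a b, ∑ k ∈ Finset.range n, (S (k + 1) + S k) a b = S n a b := by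
    intro n a b
    induction n with
    | zero => simp [hS]
    | succ n ih =>
      rw [Finset.sum_range_succ, ih, Pi.add_apply, Pi.add_apply]
      linear_combination zmod_two_add_self (S n a b)
  let s : ULift.{u} ℕ → ULift.{u} ℕ → Prop := fun a b => a.down < b.down
  have : IsWellOrder (ULift.{u} ℕ) s :=
    { wf := InvImage.wf ULift.down (wellFounded_lt (α := ℕ))
      trichotomous := fun a b h1 h2 => ULift.ext _ _ (le_antisymm (not_lt.1 h2) (not_lt.1 h1)) }
  have hlift : ∀ φ : ℕ → ZMod 2, ∑ᶠ k : ULift.{u} ℕ, φ k.down = ∑ᶠ k, φ k := fun φ =>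
    finsum_comp_equiv Equiv.ulift
  have hlt : ∀ n a b, ∑ᶠ k, (if k < n then (S (k + 1) + S k) a b else 0) = S n a b := by
    intro n a b
    rw [← hsum n a b, finsum_eq_sum_of_support_subset (s := Finset.range n)]
    · exact Finset.sum_congr rfl fun k hk => by simp [Finset.mem_range.1 hk]
    · intro k hk
      by_contra hkn
      simp only [Finset.coe_range, Set.mem_Iio] at hkn
      simp [hkn] at hk
  have key := Achieves.concat (D := D) s (T := fun n => T n.down)
    (f := fun n => S (n.down + 1) + S n.down) ?_ ?_
  · have h1 : (fun a b => ∑ᶠ j : ULift.{u} ℕ, (S (j.down + 1) + S j.down) a b) = S' := by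
      funext a b
      rw [hlift fun n => (S (n + 1) + S n) a b]
      obtain ⟨N, hN⟩ := hS' a b
      rw [← hN N le_rfl, ← hlt N a b]
      refine finsum_congr fun k => ?_
      split_ifs with hk
      · rfl
      · rw [Pi.add_apply, Pi.add_apply, hN k (not_lt.1 hk), hN (k + 1) (by omega),
          zmod_two_add_self]
    rw [h1] at key
    exact key.mono fun a b ⟨n, hn⟩ => ⟨n.down, hn⟩
  · intro j
    have : (fun a b => ∑ᶠ k : ULift.{u} ℕ, if s k j then (S (k.down + 1) + S k.down) a b else 0)
        = S j.down := by
      funext a b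
      rw [← hlt j.down a b]
      exact hlift fun k => if k < j.down then (S (k + 1) + S k) a b else 0
    convert h j.down using 2
    rw [← this]
    funext a b
    exact finsum_congr fun k => by congr
  · intro a b
    exact Set.Finite.preimage ULift.down_injective.injOn (hT a b)

theorem Achieves.trans {V : Type u} {D : Digraph V} {T₁ T₂ : V → V → Prop}
    {f g : V → V → ZMod 2} (hf : Achieves D T₁ f) (hg : Achieves (swapBy D f) T₂ g) :
    Achieves D (fun a b => T₁ a b ∨ T₂ a b) (f + g) := by
  let S : ℕ → V → V → ZMod 2 := fun n => if n = 0 then 0 else if n = 1 then f else f + g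
  have := Achieves.concat_nat (D := D)
    (T := fun n => if n = 0 then T₁ else if n = 1 then T₂ else fun _ _ => False) S (f + g)
    (by simp [S]) ?_ ?_ ?_
  · refine this.mono ?_
    rintro a b ⟨n, hn⟩
    rcases n with _ | _ | n
    · exact Or.inl hn
    · exact Or.inr hn
    · simp at hn
  · intro n
    have hxx : ∀ x : V → V → ZMod 2, x + x = 0 := fun x => by
      funext a b; exact zmod_two_add_self _
    rcases n with _ | _ | n
    · simpa [S] using hf
    · have : f + g + f = g := by rw [add_right_comm, hxx, zero_add]
      simpa [S, this] using hg
    · simp only [S]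
      simp only [Nat.add_eq_zero_iff, Nat.reduceEqDiff, if_false]
      simpa [hxx] using achieves_zero _ _
  · intro a b
    refine (Set.finite_le_nat 1).subset fun n hn => ?_
    rcases n with _ | _ | n
    · simp
    · simp
    · simp at hn
  · intro a b
    refine ⟨2, fun n hn => ?_⟩
    have h0 : n ≠ 0 := by omega
    have h1 : n ≠ 1 := by omega
    simp [S, h0, h1]

/-! ### Single cycles, duality and induced subdigraphs -/

theorem touch_eq_sum_pairInd {V : Type*} {n : ℕ} {x : Fin (n + 3) → V}
    (hx : Function.Injective x) {C : Digraph V}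
    (hC : ∀ a b, C.Adj a b ↔ ∃ i, x i = a ∧ x (i + 1) = b) (a b : V) :
    touch C a b = ∑ i, pairInd (x i) (x (i + 1)) a b := by
  by_cases h : ∃ i, pairInd (x i) (x (i + 1)) a b ≠ 0
  · obtain ⟨i, hi⟩ := h
    rw [Finset.sum_eq_single i]
    · have h1 : touch C a b ≠ 0 := by
        rw [touch_ne_zero, hC, hC]
        rcases pairInd_ne_zero.1 hi with ⟨rfl, rfl⟩ | ⟨rfl, rfl⟩
        · exact Or.inl ⟨i, rfl, rfl⟩
        · exact Or.inr ⟨i, rfl, rfl⟩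
      rw [(zmod_two_cases _).resolve_left h1, (zmod_two_cases _).resolve_left hi]
    · intro j _ hji
      by_contra hj
      -- two consecutive pairs of a cycle of length at least three are distinct
      have h2 : ∀ k : Fin (n + 3), k + 1 + 1 ≠ k := by
        intro k hk
        have h3 : (1 : Fin (n + 3)) + 1 = 0 := by
          rw [add_assoc] at hk
          exact left_eq_add.1 hk.symm
        have h4 := congrArg Fin.val h3
        rw [Fin.val_add, Fin.val_one, Fin.val_zero, Nat.mod_eq_of_lt (by omega)] at h4
        omega
      rcases pairInd_ne_zero.1 hi with ⟨h1, h1'⟩ | ⟨h1, h1'⟩ <;>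
        rcases pairInd_ne_zero.1 hj with ⟨h3, h3'⟩ | ⟨h3, h3'⟩
      · exact hji (hx (h3.symm.trans h1))
      · have e1 := hx (h1.symm.trans h3)
        have e2 := hx (h1'.symm.trans h3')
        exact h2 j (by rw [← e1, e2])
      · have e1 := hx (h1.symm.trans h3)
        have e2 := hx (h1'.symm.trans h3')
        exact h2 i (by rw [e1, ← e2])
      · exact hji (hx (h3'.symm.trans h1'))
    · simp
  · push Not at h
    rw [Finset.sum_eq_zero fun i _ => h i]
    by_contra hne
    rw [← ne_eq, touch_ne_zero, hC, hC] at hne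
    rcases hne with ⟨i, rfl, rfl⟩ | ⟨i, rfl, rfl⟩
    · exact pairInd_ne_zero.2 (Or.inl ⟨rfl, rfl⟩) (h i)
    · exact pairInd_ne_zero.2 (Or.inr ⟨rfl, rfl⟩) (h i)

theorem achieves_cycle {V : Type u} {D : Digraph V} {n : ℕ} {x : Fin (n + 3) → V}
    (hx : Function.Injective x) (h : ∀ i, D.Adj (x i) (x (i + 1))) :
    Achieves D (fun a b => ∃ i, pairInd (x i) (x (i + 1)) a b ≠ 0)
      (∑ i, pairInd (x i) (x (i + 1))) := by
  let C : Digraph V := ⟨fun a b => ∃ i, x i = a ∧ x (i + 1) = b⟩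
  have ht := touch_eq_sum_pairInd hx (C := C) fun a b => Iff.rfl
  refine ⟨PUnit, emptyRelation, inferInstance, fun _ => C, ?_, fun a b => Set.toFinite _, ?_, ?_⟩
  · intro a b _ hab
    rw [ht] at hab
    by_contra hcon
    push Not at hcon
    exact hab (Finset.sum_eq_zero fun i _ => hcon i)
  · intro i
    have h2 : IsDirectedCycle D C := by
      refine ⟨⟨n, x, hx, fun a b => Iff.rfl⟩, ?_⟩
      rintro a b ⟨i, rfl, rfl⟩
      exact h i
    convert h2 using 1
    convert swapBy_zero D using 2
    funext a b
    exact finsum_eq_zero_of_forall_eq_zero fun k => if_neg not_false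
  · funext a b
    rw [finsum_eq_single _ PUnit.unit (by simp), ht, Finset.sum_apply, Finset.sum_apply]

/-- The digraph with all arcs reversed. -/
def dual {V : Type*} (D : Digraph V) : Digraph V := ⟨fun a b => D.Adj b a⟩

theorem IsTournament.dual {V : Type*} {D : Digraph V} (hD : IsTournament D) :
    IsTournament (dual D) :=
  ⟨fun v => hD.1 v, fun a b hab => (xor_comm _ _).mp (hD.2 a b hab)⟩

theorem dual_swapBy {V : Type*} (D : Digraph V) (f : V → V → ZMod 2)
    (hf : ∀ a b, f a b = f b a) : dual (swapBy D f) = swapBy (dual D) f := by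
  ext a b
  simp [dual, swapBy, hf b a]

theorem touch_dual {V : Type*} (C : Digraph V) : touch (dual C) = touch C := by
  funext a b
  exact touch_symm C b a

theorem IsDirectedCycle.dual {V : Type*} {D C : Digraph V} (h : IsDirectedCycle D C) :
    IsDirectedCycle (dual D) (dual C) := by
  obtain ⟨⟨n, x, hx, hC⟩, hCD⟩ := h
  refine ⟨⟨n, fun i => x (-i), fun i j hij => neg_injective (hx hij), fun a b => ?_⟩,
    fun a b hab => hCD b a hab⟩
  refine (hC b a).trans ⟨?_, ?_⟩
  · rintro ⟨i, h1, h2⟩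
    exact ⟨-(i + 1), by simpa using h2, by simpa using h1⟩
  · rintro ⟨i, h1, h2⟩
    exact ⟨-(i + 1), h2, by simpa using h1⟩

theorem Achieves.dual {V : Type u} {D : Digraph V} {T : V → V → Prop} {f : V → V → ZMod 2}
    (h : Achieves D T f) : Achieves (dual D) T f := by
  obtain ⟨I, r, w, C, h1, h2, h3, h4⟩ := h
  refine ⟨I, r, w, fun i => CycleReversal.dual (C i), ?_, ?_, ?_, ?_⟩ <;> simp only [touch_dual]
  · exact h1
  · exact h2
  · intro i
    have := (h3 i).dual
    rwa [dual_swapBy] at this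
    intro a b
    simp only [touch_symm _ a b]
  · exact h4

open scoped Classical in
/-- Extension by zero of a function on pairs of elements of `X`. -/
noncomputable def extendPairs {V : Type*} (X : Set V) (f : X → X → ZMod 2) : V → V → ZMod 2 :=
  fun a b => if h : a ∈ X ∧ b ∈ X then f ⟨a, h.1⟩ ⟨b, h.2⟩ else 0

theorem extendPairs_of_mem {V : Type*} {X : Set V} (f : X → X → ZMod 2) (a b : X) :
    extendPairs X f a b = f a b := by
  simp [extendPairs]

theorem extendPairs_of_not {V : Type*} {X : Set V} (f : X → X → ZMod 2) {a b : V}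
    (h : ¬ (a ∈ X ∧ b ∈ X)) : extendPairs X f a b = 0 := by
  simp [extendPairs, h]

theorem induced_swapBy_extendPairs {V : Type*} (D : Digraph V) (X : Set V) (f : X → X → ZMod 2) :
    induced (swapBy D (extendPairs X f)) X = swapBy (induced D X) f := by
  ext a b
  simp [induced, swapBy, extendPairs_of_mem]

/-- A reversal sequence of an induced subdigraph is one of the whole digraph. -/
theorem Achieves.of_induced {V : Type u} {D : Digraph V} {X : Set V} {T : X → X → Prop}
    {f : X → X → ZMod 2} (h : Achieves (induced D X) T f) :
    Achieves D (fun a b => a ∈ X ∧ b ∈ X) (extendPairs X f) := by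
  classical
  obtain ⟨I, r, w, C, -, h2, h3, h4⟩ := h
  let C' : I → Digraph V := fun i => ⟨fun a b => ∃ ha hb, (C i).Adj ⟨a, ha⟩ ⟨b, hb⟩⟩
  have ht : ∀ i, touch (C' i) = extendPairs X (touch (C i)) := by
    intro i
    funext a b
    by_cases hab : a ∈ X ∧ b ∈ X
    · obtain ⟨ha, hb⟩ := hab
      rw [extendPairs_of_mem _ ⟨a, ha⟩ ⟨b, hb⟩]
      simp [touch, C', ha, hb]
    · rw [extendPairs_of_not _ hab]
      by_contra hne
      rw [← ne_eq, touch_ne_zero] at hne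
      rcases hne with ⟨ha, hb, -⟩ | ⟨hb, ha, -⟩ <;> exact hab ⟨ha, hb⟩
  refine ⟨I, r, w, C', ?_, ?_, ?_, ?_⟩
  · intro a b i hi
    rw [ht] at hi
    by_contra hab
    exact hi (extendPairs_of_not _ hab)
  · intro a b
    by_cases hab : a ∈ X ∧ b ∈ X
    · obtain ⟨ha, hb⟩ := hab
      simpa only [ht, extendPairs_of_mem _ ⟨a, ha⟩ ⟨b, hb⟩] using h2 ⟨a, ha⟩ ⟨b, hb⟩
    · simp [ht, extendPairs_of_not _ hab]
  · intro i
    obtain ⟨⟨n, x, hx, hC⟩, hCD⟩ := h3 i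
    refine ⟨⟨n, fun i => (x i : V), fun i j hij => hx (Subtype.ext hij), fun a b => ?_⟩, ?_⟩
    · constructor
      · rintro ⟨ha, hb, hab⟩
        obtain ⟨k, h1, h2⟩ := (hC _ _).1 hab
        exact ⟨k, congrArg Subtype.val h1, congrArg Subtype.val h2⟩
      · rintro ⟨k, rfl, rfl⟩
        exact ⟨(x k).2, (x (k + 1)).2, (hC _ _).2 ⟨k, rfl, rfl⟩⟩
    · rintro a b ⟨ha, hb, hab⟩
      have h5 := hCD _ _ hab
      simp only [swapBy, induced] at h5 ⊢
      simpa only [ht, extendPairs_of_mem _ ⟨a, ha⟩ ⟨b, hb⟩] using h5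
  · funext a b
    by_cases hab : a ∈ X ∧ b ∈ X
    · obtain ⟨ha, hb⟩ := hab
      simp only [ht, extendPairs_of_mem _ ⟨a, ha⟩ ⟨b, hb⟩, h4]
    · simp [ht, extendPairs_of_not _ hab]

theorem IsTournament.induced {V : Type*} {D : Digraph V} (hD : IsTournament D) (X : Set V) :
    IsTournament (induced D X) :=
  ⟨fun v => hD.1 v, fun a b hab => hD.2 a b fun h => hab (Subtype.ext h)⟩

/-! ### Reversing a single arc -/

theorem injective_vecCons_iff {V : Type*} {n : ℕ} (a : V) (x : Fin n → V) :
    Function.Injective (Matrix.vecCons a x) ↔ (∀ i, a ≠ x i) ∧ Function.Injective x := by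
  rw [Matrix.vecCons, Fin.cons_injective_iff, Set.mem_range]
  push Not
  simp only [ne_comm]

/-- If `u → v` is an arc and `s 0, s 1, …` are the disjoint sets of inner vertices of paths from
`v` to `u` with sets of arcs `c 0, c 1, …`, then reversing the cycle formed by `uv` and the first
path, then the cycle formed by the reversed first and the second path, and so on, reverses `uv`
and nothing else in the limit. -/
theorem achieves_pairInd_of_paths {V : Type u} {D : Digraph V} {u v : V} {s : ℕ → Finset V}
    (hs : Pairwise fun m n => Disjoint (s m) (s n)) (c : ℕ → V → V → ZMod 2)
    (hc : ∀ n a b, c n a b ≠ 0 → a ∈ s n ∨ b ∈ s n)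
    {T₀ : V → V → Prop} (h0 : Achieves D T₀ (pairInd u v + c 0))
    (hT₀ : ∀ a b, T₀ a b → pairInd u v a b ≠ 0 ∨ a ∈ s 0 ∨ b ∈ s 0)
    {T : ℕ → V → V → Prop}
    (h : ∀ n, Achieves (swapBy D (pairInd u v + c n)) (T n) (c n + c (n + 1)))
    (hT : ∀ n a b, T n a b → (a ∈ s n ∨ b ∈ s n) ∨ (a ∈ s (n + 1) ∨ b ∈ s (n + 1))) :
    Achieves D (fun a b => pairInd u v a b ≠ 0 ∨ (∃ n, a ∈ s n) ∨ ∃ n, b ∈ s n)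
      (pairInd u v) := by
  have hsub : ∀ a : V, {n | a ∈ s n}.Finite := fun a =>
    Set.Subsingleton.finite fun m hm n hn => by
      by_contra hmn
      exact Finset.disjoint_left.1 (hs hmn) hm hn
  have hsub2 : ∀ a b : V, {n | a ∈ s n ∨ b ∈ s n}.Finite := fun a b => (hsub a).union (hsub b)
  let S : ℕ → V → V → ZMod 2 := fun n => n.casesOn 0 fun n => pairInd u v + c n
  let T' : ℕ → V → V → Prop := fun n => n.casesOn T₀ T
  have key := Achieves.concat_nat (D := D) (T := T') S (pairInd u v) rfl ?_ ?_ ?_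
  · refine key.mono ?_
    rintro a b ⟨_ | n, hn⟩
    · rcases hT₀ a b hn with h | h | h
      exacts [Or.inl h, Or.inr (Or.inl ⟨_, h⟩), Or.inr (Or.inr ⟨_, h⟩)]
    · rcases hT n a b hn with (h | h) | (h | h)
      exacts [Or.inr (Or.inl ⟨_, h⟩), Or.inr (Or.inr ⟨_, h⟩), Or.inr (Or.inl ⟨_, h⟩),
        Or.inr (Or.inr ⟨_, h⟩)]
  · rintro (_ | n)
    · simpa [S, T'] using h0
    · have : pairInd u v + c (n + 1) + (pairInd u v + c n) = c n + c (n + 1) := by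
        funext a b
        simp only [Pi.add_apply]
        linear_combination zmod_two_add_self (pairInd u v a b)
      simp only [S, T', this]
      exact h n
  · intro a b
    refine ((Set.finite_singleton 0).union (((hsub2 a b).image (· + 1)).union
      (((hsub2 a b).preimage (f := fun n => n) Function.injective_id.injOn)))).subset ?_
    rintro (_ | n) hn
    · simp
    · rcases hT n a b hn with h | h
      · exact Or.inr (Or.inl ⟨n, h, rfl⟩)
      · exact Or.inr (Or.inr h)
  · intro a b
    obtain ⟨N, hN⟩ := (hsub2 a b).bddAbove
    refine ⟨N + 2, ?_⟩
    rintro (_ | n) hn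
    · omega
    · have : c n a b = 0 := by
        by_contra hne
        have := hN (hc n a b hne)
        omega
      simp [S, this]

/-- `s` is the set of inner vertices of a directed path of length two from `v` to `u`. -/
def IsTwoPath {V : Type*} (D : Digraph V) (v u : V) (s : Finset V) : Prop :=
  ∃ z, s = {z} ∧ D.Adj v z ∧ D.Adj z u

open scoped Classical in
/-- `s` is the set of inner vertices of a directed path of length three from `v` to `u`. -/
def IsThreePath {V : Type*} (D : Digraph V) (v u : V) (s : Finset V) : Prop :=
  ∃ p q, s = {p, q} ∧ D.Adj v p ∧ D.Adj p q ∧ D.Adj q u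

theorem achieves_pairInd_of_isTwoPath {V : Type u} {D : Digraph V} (hD : IsTournament D) {u v : V}
    (huv : D.Adj u v) {s : ℕ → Finset V} (hs : Pairwise fun m n => Disjoint (s m) (s n))
    (h : ∀ n, IsTwoPath D v u (s n)) :
    Achieves D (fun a b => pairInd u v a b ≠ 0 ∨ (∃ n, a ∈ s n) ∨ ∃ n, b ∈ s n)
      (pairInd u v) := by
  choose z hz hvz hzu using h
  have hne : ∀ m n, m ≠ n → z m ≠ z n := fun m n hmn => by
    have := hs hmn
    simpa [hz] using this
  have huv' := hD.ne huv
  have hvz' := fun n => hD.ne (hvz n)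
  have hzu' := fun n => hD.ne (hzu n)
  have e0 : ∀ i, D.Adj ((![u, v, z 0] : Fin 3 → V) i) (![u, v, z 0] (i + 1)) := by
    intro i; fin_cases i
    exacts [huv, hvz 0, hzu 0]
  have i0 : Function.Injective (![u, v, z 0] : Fin 3 → V) := by
    simp only [injective_vecCons_iff, Fin.forall_fin_succ]
    simp [huv', hvz' 0, (hzu' 0).symm, Function.injective_of_subsingleton]
  refine achieves_pairInd_of_paths hs (fun n => pairInd v (z n) + pairInd (z n) u) ?_
    (T₀ := fun a b => ∃ i : Fin 3, pairInd ((![u, v, z 0] : Fin 3 → V) i) (![u, v, z 0] (i + 1))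
      a b ≠ 0) ?_ ?_ (T := fun n a b => ∃ i : Fin 4,
        pairInd ((![v, z (n + 1), u, z n] : Fin 4 → V) i)
          (![v, z (n + 1), u, z n] (i + 1)) a b ≠ 0) ?_ ?_
  · intro n a b hab
    by_contra hcon
    simp only [hz, Finset.mem_singleton, not_or] at hcon
    apply hab
    simp [pairInd, hcon.1, hcon.2]
  · have := achieves_cycle i0 e0
    convert this using 1
    rw [Fin.sum_univ_three, add_assoc]
    rfl
  · rintro a b ⟨i, hi⟩
    simp only [hz, Finset.mem_singleton]
    rw [pairInd_ne_zero] at hi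
    fin_cases i
    · exact Or.inl (pairInd_ne_zero.2 hi)
    · rcases hi with ⟨h1, h2⟩ | ⟨h1, h2⟩
      exacts [Or.inr (Or.inr h2), Or.inr (Or.inl h1)]
    · rcases hi with ⟨h1, h2⟩ | ⟨h1, h2⟩
      exacts [Or.inr (Or.inl h1), Or.inr (Or.inr h2)]
  · intro n
    have hzz := hne n (n + 1) (by omega)
    have e1 : ∀ i, (swapBy D (pairInd u v + (pairInd v (z n) + pairInd (z n) u))).Adj
        ((![v, z (n + 1), u, z n] : Fin 4 → V) i) (![v, z (n + 1), u, z n] (i + 1)) := by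
      intro i
      fin_cases i
      · refine (swapBy_adj_zero ?_).2 (hvz (n + 1))
        simp [pairInd, huv'.symm, hzz.symm, hzu', hvz' n]
      · refine (swapBy_adj_zero ?_).2 (hzu (n + 1))
        simp [pairInd, huv', hzz.symm, hzu', (hvz' _).symm]
      · refine (swapBy_adj_one ?_).2 (hzu n)
        simp [pairInd, huv', hzu', (hvz' _).symm, (hzu' _).symm]
      · refine (swapBy_adj_one ?_).2 (hvz n)
        simp [pairInd, huv'.symm, hzu', (hvz' _).symm]
    have i1 : Function.Injective (![v, z (n + 1), u, z n] : Fin 4 → V) := by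
      simp only [injective_vecCons_iff, Fin.forall_fin_succ]
      simp [huv'.symm, hvz', hzu', (hzu' _).symm, hzz.symm, Function.injective_of_subsingleton]
    have := achieves_cycle i1 e1
    convert this using 1
    rw [Fin.sum_univ_four]
    change _ = pairInd v (z (n + 1)) + pairInd (z (n + 1)) u + pairInd u (z n) + pairInd (z n) v
    rw [pairInd_comm u (z n), pairInd_comm (z n) v]
    abel
  · rintro n a b ⟨i, hi⟩
    simp only [hz, Finset.mem_singleton]
    rw [pairInd_ne_zero] at hi
    fin_cases i <;> simp at hi <;> tauto

theorem achieves_pairInd_of_isThreePath {V : Type u} {D : Digraph V} (hD : IsTournament D)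
    {u v : V} (huv : D.Adj u v) {s : ℕ → Finset V}
    (hs : Pairwise fun m n => Disjoint (s m) (s n)) (h : ∀ n, IsThreePath D v u (s n)) :
    Achieves D (fun a b => pairInd u v a b ≠ 0 ∨ (∃ n, a ∈ s n) ∨ ∃ n, b ∈ s n)
      (pairInd u v) := by
  choose p q hpq hvp hpq' hqu using h
  have hne : ∀ m n, m ≠ n → (p m ≠ p n ∧ p m ≠ q n) ∧ q m ≠ p n ∧ q m ≠ q n := fun m n hmn => by
    have := hs hmn
    simp only [hpq, Finset.disjoint_insert_left, Finset.disjoint_singleton_left, Finset.mem_insert,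
      Finset.mem_singleton, not_or] at this
    exact this
  have huv' := hD.ne huv
  have hvp' := fun n => hD.ne (hvp n)
  have hpq'' := fun n => hD.ne (hpq' n)
  have hqu' := fun n => hD.ne (hqu n)
  have hup' : ∀ n, u ≠ p n := fun n h => hD.asymm huv (h ▸ hvp n)
  have hvq' : ∀ n, v ≠ q n := fun n h => hD.asymm huv (h ▸ hqu n)
  have e0 : ∀ i, D.Adj ((![u, v, p 0, q 0] : Fin 4 → V) i) (![u, v, p 0, q 0] (i + 1)) := by
    intro i; fin_cases i
    exacts [huv, hvp 0, hpq' 0, hqu 0]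
  have i0 : Function.Injective (![u, v, p 0, q 0] : Fin 4 → V) := by
    simp only [injective_vecCons_iff, Fin.forall_fin_succ]
    simp [huv', hvp' 0, (hqu' 0).symm, hpq'' 0, hup', hvq', Function.injective_of_subsingleton]
  refine achieves_pairInd_of_paths hs
    (fun n => pairInd v (p n) + pairInd (p n) (q n) + pairInd (q n) u) ?_
    (T₀ := fun a b => ∃ i : Fin 4, pairInd ((![u, v, p 0, q 0] : Fin 4 → V) i)
      (![u, v, p 0, q 0] (i + 1)) a b ≠ 0) ?_ ?_ (T := fun n a b => ∃ i : Fin 6,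
        pairInd ((![v, p (n + 1), q (n + 1), u, q n, p n] : Fin 6 → V) i)
          (![v, p (n + 1), q (n + 1), u, q n, p n] (i + 1)) a b ≠ 0) ?_ ?_
  · intro n a b hab
    by_contra hcon
    simp only [hpq, Finset.mem_singleton, Finset.mem_insert, not_or] at hcon
    apply hab
    simp [pairInd, hcon.1, hcon.2]
  · have := achieves_cycle i0 e0
    convert this using 1
    rw [Fin.sum_univ_four]
    change _ = pairInd u v + pairInd v (p 0) + pairInd (p 0) (q 0) + pairInd (q 0) u
    abel
  · rintro a b ⟨i, hi⟩
    simp only [hpq, Finset.mem_singleton, Finset.mem_insert]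
    rw [pairInd_ne_zero] at hi ⊢
    fin_cases i <;> simp at hi <;> tauto
  · intro n
    obtain ⟨⟨h1, h2⟩, h3, h4⟩ := hne n (n + 1) (by omega)
    have e1 : ∀ i, (swapBy D
        (pairInd u v + (pairInd v (p n) + pairInd (p n) (q n) + pairInd (q n) u))).Adj
        ((![v, p (n + 1), q (n + 1), u, q n, p n] : Fin 6 → V) i)
        (![v, p (n + 1), q (n + 1), u, q n, p n] (i + 1)) := by
      intro i
      fin_cases i
      · refine (swapBy_adj_zero ?_).2 (hvp (n + 1))
        simp [pairInd, huv'.symm, h1.symm, h3.symm, (hup' _).symm, hvp', hvq']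
      · refine (swapBy_adj_zero ?_).2 (hpq' (n + 1))
        simp [pairInd, h1.symm, h3.symm, (hup' _).symm, (hvp' _).symm]
      · refine (swapBy_adj_zero ?_).2 (hqu (n + 1))
        simp [pairInd, huv', h2.symm, h4.symm, hqu' _, (hvq' _).symm]
      · refine (swapBy_adj_one ?_).2 (hqu n)
        simp [pairInd, huv', hup', (hvq' _).symm, (hqu' _).symm]
      · refine (swapBy_adj_one ?_).2 (hpq' n)
        simp [pairInd, hqu', (hpq'' _).symm, (hvq' _).symm, (hup' _).symm, (hvp' _).symm]
      · refine (swapBy_adj_one ?_).2 (hvp n)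
        simp [pairInd, huv'.symm, (hup' _).symm, (hvp' _).symm, hvq', hpq'']
    have i1 : Function.Injective (![v, p (n + 1), q (n + 1), u, q n, p n] : Fin 6 → V) := by
      simp only [injective_vecCons_iff, Fin.forall_fin_succ]
      simp [huv'.symm, hvp', hvq', hpq'', hqu', hup', (hup' _).symm, (hqu' _).symm, h1.symm,
        h2.symm, h3.symm, h4.symm, (hpq'' _).symm, Function.injective_of_subsingleton]
    have := achieves_cycle i1 e1
    convert this using 1
    rw [Fin.sum_univ_six]
    change _ = pairInd v (p (n + 1)) + pairInd (p (n + 1)) (q (n + 1)) + pairInd (q (n + 1)) u +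
      pairInd u (q n) + pairInd (q n) (p n) + pairInd (p n) v
    rw [pairInd_comm u (q n), pairInd_comm (q n) (p n), pairInd_comm (p n) v]
    abel
  · rintro n a b ⟨i, hi⟩
    simp only [hpq, Finset.mem_singleton, Finset.mem_insert]
    rw [pairInd_ne_zero] at hi
    fin_cases i <;> simp at hi <;> tauto

/-! ### Disjoint choices by transfinite recursion -/

/-- Transfinite greedy choice of disjoint members of given families of disjoint finite sets. The
member chosen for `j` also avoids the finite sets `X i` with `i` before `j`. -/
theorem exists_disjoint_choice {V J : Type u} {e : J → Ordinal.{u}} (he : Function.Injective e)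
    (X : J → Finset V) {S : J → Set (Finset V)} (hS : ∀ j, (S j).PairwiseDisjoint id)
    (hinf : ∀ j, ℵ₀ ≤ #(S j)) (hcard : ∀ j, (e j).card < #(S j)) :
    ∃ Q : J → Finset V, (∀ j, Q j ∈ S j) ∧
      ∀ i j, e i < e j → Disjoint (Q i) (Q j) ∧ Disjoint (X i) (Q j) := by
  classical
  have step : ∀ (j : J) (Q : ∀ i, e i < e j → Finset V), ∃ s ∈ S j,
      ∀ i (hi : e i < e j), Disjoint (Q i hi) s ∧ Disjoint (X i) s := by
    intro j Q
    let U : Set V := ⋃ i : {i // e i < e j}, ((Q i.1 i.2 ∪ X i.1 : Finset V) : Set V)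
    have hι : #{i // e i < e j} ≤ (e j).card := by
      have h1 : Function.Injective (fun i : {i // e i < e j} => (⟨e i.1, i.2⟩ : Set.Iio (e j))) :=
        fun a b hab => Subtype.ext (he (congrArg Subtype.val hab))
      have h2 := Cardinal.mk_le_of_injective (f := fun i : ULift.{u + 1} {i // e i < e j} =>
        (⟨e i.down.1, i.down.2⟩ : Set.Iio (e j))) fun a b hab => ULift.ext _ _ (h1 hab)
      rw [Cardinal.mk_uLift, Cardinal.mk_Iio_ordinal, Cardinal.lift_le] at h2
      exact h2
    have hU : #U < #(S j) := by
      rcases lt_or_ge #{i // e i < e j} ℵ₀ with hfin | hfin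
      · have : Finite {i // e i < e j} := Cardinal.lt_aleph0_iff_finite.1 hfin
        have : U.Finite := Set.finite_iUnion fun i => Finset.finite_toSet _
        exact (Cardinal.lt_aleph0_iff_set_finite.2 this).trans_le (hinf j)
      · calc #U ≤ Cardinal.sum fun i : {i // e i < e j} =>
              #((Q i.1 i.2 ∪ X i.1 : Finset V) : Set V) := mk_iUnion_le_sum_mk
          _ ≤ Cardinal.sum fun _ : {i // e i < e j} => (ℵ₀ : Cardinal.{u}) :=
              Cardinal.sum_le_sum _ _ fun i => (Cardinal.lt_aleph0_iff_set_finite.2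
                (Finset.finite_toSet _)).le
          _ = #{i // e i < e j} := by
              rw [Cardinal.sum_const', Cardinal.mul_aleph0_eq hfin]
          _ ≤ (e j).card := hι
          _ < #(S j) := hcard j
    by_contra! hcon
    have hmeet : ∀ s : S j, ∃ x, x ∈ s.1 ∧ x ∈ U := by
      intro s
      obtain ⟨i, hi, h⟩ := hcon s.1 s.2
      have : ¬ Disjoint (Q i hi ∪ X i) s.1 := by
        rw [Finset.disjoint_union_left]
        exact fun h' => h h'.1 h'.2
      rw [Finset.not_disjoint_iff] at this
      obtain ⟨x, hx, hxs⟩ := this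
      exact ⟨x, hxs, Set.mem_iUnion.2 ⟨⟨i, hi⟩, hx⟩⟩
    choose g hg hgU using hmeet
    refine hU.not_ge (Cardinal.mk_le_of_injective (f := fun s => (⟨g s, hgU s⟩ : U)) ?_)
    intro s t hst
    have hst' : g s = g t := congrArg Subtype.val hst
    by_contra hne
    have := hS j s.2 t.2 (fun h => hne (Subtype.ext h))
    exact Finset.disjoint_left.1 this (hg s) (hst' ▸ hg t)
  choose G hGS hG using step
  have wf : WellFounded fun i j : J => e i < e j := InvImage.wf e wellFounded_lt
  refine ⟨wf.fix G, fun j => ?_, fun i j hij => ?_⟩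
  · rw [wf.fix_eq]; exact hGS _ _
  · rw [wf.fix_eq G j]; exact hG j (fun i _ => wf.fix G i) i hij

/-- Keys for `achieves_pairsInd` if there are at most `κ` arcs in total, and at least `κ` paths for
each of them. -/
theorem exists_key_of_mk_le {F : Type u} {κ : Cardinal.{u}} (hκ : ℵ₀ ≤ κ) (hF : #F ≤ κ) :
    ∃ e : F × ℕ → Ordinal.{u}, Function.Injective e ∧ ∀ x, (e x).card < κ := by
  have h1 : #(F × ULift.{u} ℕ) ≤ #κ.ord.ToType := by
    rw [mk_ord_toType, mk_prod, lift_id, lift_id, mk_uLift, mk_nat, lift_aleph0]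
    exact mul_le_of_le hκ hF hκ
  obtain ⟨i⟩ := h1
  refine ⟨fun x => (Ordinal.ToType.toOrd (i (x.1, ⟨x.2⟩))).1, ?_, fun x => ?_⟩
  · rintro ⟨p, m⟩ ⟨q, n⟩ h
    have := i.injective (Ordinal.ToType.mk.symm.injective (Subtype.ext h))
    simpa using this
  · rw [← lt_ord]
    exact (Ordinal.ToType.toOrd (i (x.1, ⟨x.2⟩))).2

/-- Keys for `achieves_pairsInd` if the numbers of paths vary: it suffices that there are more than
`ρ p` paths for the arc `p`, and that at most `ν⁺` arcs have rank `ν`. The keys of those arcs are the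
ordinals from the interval between the initial ordinals of `ν` and `ν⁺`. -/
theorem exists_key_of_rank {F : Type u} (ρ : F → Cardinal.{u}) (hρ : ∀ p, ℵ₀ ≤ ρ p)
    (hcard : ∀ ν, ℵ₀ ≤ ν → #{p | ρ p = ν} ≤ Order.succ ν) :
    ∃ e : F × ℕ → Ordinal.{u}, Function.Injective e ∧ ∀ x, (e x).card = ρ x.1 := by
  have h1 : ∀ ν : {ν : Cardinal.{u} // ℵ₀ ≤ ν}, ∃ e : {p | ρ p = ν.1} × ℕ → Ordinal.{u},
      Function.Injective e ∧ ∀ x, (e x).card < Order.succ ν.1 := fun ν =>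
    exists_key_of_mk_le (ν.2.trans (Order.le_succ _)) (hcard ν.1 ν.2)
  choose e he hlt using h1
  have hc : ∀ x : F × ℕ, ((ρ x.1).ord + e ⟨ρ x.1, hρ _⟩ (⟨x.1, rfl⟩, x.2)).card = ρ x.1 := by
    intro x
    rw [Ordinal.card_add, card_ord]
    exact add_eq_left (hρ _) (Order.lt_succ_iff.1 (hlt _ _))
  refine ⟨fun x => (ρ x.1).ord + e ⟨ρ x.1, hρ _⟩ (⟨x.1, rfl⟩, x.2), ?_, hc⟩
  rintro ⟨p, m⟩ ⟨q, n⟩ h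
  have hpq : ρ p = ρ q := by
    have := congrArg Ordinal.card h
    rwa [hc (p, m), hc (q, n)] at this
  have key : ∀ (ν : Cardinal.{u}) (hν : ℵ₀ ≤ ν) (hp : ρ p = ν) (hq : ρ q = ν),
      ν.ord + e ⟨ν, hν⟩ (⟨p, hp⟩, m) = ν.ord + e ⟨ν, hν⟩ (⟨q, hq⟩, n) → p = q ∧ m = n := by
    intro ν hν hp hq h
    have := he _ (add_left_cancel h)
    simpa using this
  have move : ∀ (ν : Cardinal.{u}) (hν : ℵ₀ ≤ ν) (hq : ρ q = ν),
      (ρ q).ord + e ⟨ρ q, hρ q⟩ (⟨q, rfl⟩, n) = ν.ord + e ⟨ν, hν⟩ (⟨q, hq⟩, n) := by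
    rintro _ _ rfl; rfl
  have := key (ρ p) (hρ p) rfl hpq.symm (h.trans (move _ _ _))
  rw [this.1, this.2]

/-! ### Reversing a set of arcs -/

open scoped Classical in
/-- The indicator function of the unordered pairs underlying the arcs in `F`. -/
noncomputable def pairsInd {V : Type*} (F : Set (V × V)) : V → V → ZMod 2 :=
  fun a b => if (a, b) ∈ F ∨ (b, a) ∈ F then 1 else 0

theorem pairsInd_ne_zero {V : Type*} {F : Set (V × V)} {a b : V} :
    pairsInd F a b ≠ 0 ↔ (a, b) ∈ F ∨ (b, a) ∈ F := by
  unfold pairsInd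
  split_ifs with h <;> simp [h]

theorem swapBy_pairsInd_adj {V : Type*} {D : Digraph V} (hD : IsTournament D) {F : Set (V × V)}
    (hF : ∀ p ∈ F, D.Adj p.1 p.2) (a b : V) :
    (swapBy D (pairsInd F)).Adj a b ↔ (D.Adj a b ∧ (a, b) ∉ F) ∨ (b, a) ∈ F := by
  by_cases h : (a, b) ∈ F ∨ (b, a) ∈ F
  · rw [swapBy_adj_one (pairsInd_ne_zero.2 h)]
    rcases h with h | h
    · have h1 := hD.asymm (hF _ h)
      have h2 : (b, a) ∉ F := fun h' => h1 (hF _ h')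
      simp [h, h1, h2]
    · simp [h, hF _ h]
  · rw [swapBy_adj_zero (by_contra fun h' => h (pairsInd_ne_zero.1 h'))]
    simp only [not_or] at h
    simp [h.1, h.2]

/-- A notion of sets of inner vertices of paths from `v` to `u` that is determined by the arcs at
these vertices, and for which infinitely many disjoint such sets permit to reverse an arc `uv`. -/
structure IsFlipping (Conn : Digraph V → V → V → Finset V → Prop) : Prop where
  flip : ∀ {E : Digraph V}, IsTournament E → ∀ {u v : V} {s : ℕ → Finset V}, E.Adj u v →
    (Pairwise fun m n => Disjoint (s m) (s n)) → (∀ n, Conn E v u (s n)) →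
    Achieves E (fun a b => pairInd u v a b ≠ 0 ∨ (∃ n, a ∈ s n) ∨ ∃ n, b ∈ s n) (pairInd u v)
  congr : ∀ {E E' : Digraph V} {v u : V} {s : Finset V},
    (∀ a b, a ∈ s ∨ b ∈ s → (E.Adj a b ↔ E'.Adj a b)) → Conn E v u s → Conn E' v u s

theorem isFlipping_isTwoPath {V : Type u} : IsFlipping (IsTwoPath (V := V)) where
  flip hE _ _ _ huv hs h := achieves_pairInd_of_isTwoPath hE huv hs h
  congr := by
    rintro E E' v u s h ⟨z, rfl, h1, h2⟩
    exact ⟨z, rfl, (h _ _ (by simp)).1 h1, (h _ _ (by simp)).1 h2⟩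

theorem isFlipping_isThreePath {V : Type u} : IsFlipping (IsThreePath (V := V)) where
  flip hE _ _ _ huv hs h := achieves_pairInd_of_isThreePath hE huv hs h
  congr := by
    rintro E E' v u s h ⟨p, q, rfl, h1, h2, h3⟩
    exact ⟨p, q, rfl, (h _ _ (by simp)).1 h1, (h _ _ (by simp)).1 h2, (h _ _ (by simp)).1 h3⟩

/-- All arcs in `F` can be reversed, and no others, if for each arc `uv` in `F` there are
sufficiently many disjoint paths from `v` to `u`. Such paths are chosen for all arcs in `F` at once,
disjointly and so that they avoid the arcs in `F` that are reversed earlier. -/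
theorem achieves_pairsInd {V : Type u} {D : Digraph V} (hD : IsTournament D) {F : Set (V × V)}
    (hF : ∀ p ∈ F, D.Adj p.1 p.2) {Conn : Digraph V → V → V → Finset V → Prop}
    (hConn : IsFlipping Conn) {e : F × ℕ → Ordinal.{u}} (he : Function.Injective e)
    {S : F → Set (Finset V)} (hS : ∀ p, (S p).PairwiseDisjoint id) (hinf : ∀ p, ℵ₀ ≤ #(S p))
    (hcard : ∀ x, (e x).card < #(S x.1)) (hSC : ∀ p, ∀ s ∈ S p, Conn D p.1.2 p.1.1 s) :
    Achieves D (fun _ _ => True) (pairsInd F) := by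
  classical
  obtain ⟨Q, hQS, hQ⟩ := exists_disjoint_choice he (fun x : F × ℕ => {x.1.1.1, x.1.1.2})
    (S := fun x => S x.1) (fun x => hS x.1) (fun x => hinf x.1) hcard
  have hQd : ∀ x y, x ≠ y → Disjoint (Q x) (Q y) := by
    intro x y hxy
    rcases lt_trichotomy (e x) (e y) with h | h | h
    · exact (hQ x y h).1
    · exact absurd (he h) hxy
    · exact (hQ y x h).1.symm
  -- the arcs are reversed in the order of the least keys of their paths, so that the paths of an arc
  -- avoid the arcs reversed earlier
  let k : F → Ordinal := fun p => sInf (Set.range fun n => e (p, n))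
  have hk : ∀ p, ∃ n, e (p, n) = k p := fun p => csInf_mem (Set.range_nonempty _)
  have hk' : ∀ p n, k p ≤ e (p, n) := fun p n => csInf_le' ⟨n, rfl⟩
  have hkinj : Function.Injective k := by
    intro p q hpq
    obtain ⟨m, hm⟩ := hk p
    obtain ⟨n, hn⟩ := hk q
    exact congrArg Prod.fst (he (hm.trans (hpq.trans hn.symm)))
  obtain ⟨r, hr⟩ : ∃ r : F → F → Prop, ∀ p q, r p q ↔ k p < k q := ⟨_, fun _ _ => Iff.rfl⟩
  have : IsWellOrder F r :=
    { wf := Subrelation.wf (fun h => (hr _ _).1 h) (InvImage.wf k wellFounded_lt)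
      trichotomous := fun a b h1 h2 => hkinj (le_antisymm
        (not_lt.1 fun h => h2 ((hr _ _).2 h)) (not_lt.1 fun h => h1 ((hr _ _).2 h))) }
  have hone : ∀ a b, {p : F | pairInd p.1.1 p.1.2 a b ≠ 0}.Finite := by
    intro a b
    refine ((Set.finite_singleton (b, a)).insert (a, b)).preimage
      (f := (Subtype.val : F → V × V)) Subtype.val_injective.injOn |>.subset ?_
    rintro ⟨⟨u, v⟩, hp⟩ h
    rcases pairInd_ne_zero.1 h with ⟨rfl, rfl⟩ | ⟨rfl, rfl⟩ <;> simp
  have huniq : ∀ a, {p : F | ∃ n, a ∈ Q (p, n)}.Finite := fun a =>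
    Set.Subsingleton.finite <| by
      rintro p ⟨m, hm⟩ q ⟨n, hn⟩
      by_contra hpq
      exact Finset.disjoint_left.1 (hQd (p, m) (q, n) fun h => hpq (congrArg Prod.fst h)) hm hn
  have key := Achieves.concat r (D := D) (f := fun p => pairInd p.1.1 p.1.2)
    (T := fun p a b => pairInd p.1.1 p.1.2 a b ≠ 0 ∨ (∃ n, a ∈ Q (p, n)) ∨ ∃ n, b ∈ Q (p, n))
    ?_ ?_
  · convert key.mono fun _ _ _ => trivial using 1
    funext a b
    by_cases h : (a, b) ∈ F ∨ (b, a) ∈ F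
    · rw [(zmod_two_cases _).resolve_left (pairsInd_ne_zero.2 h)]
      obtain ⟨p, hp, hpab⟩ : ∃ p, ∃ hp : p ∈ F, pairInd p.1 p.2 a b ≠ 0 := by
        rcases h with h | h
        · exact ⟨_, h, pairInd_ne_zero.2 (Or.inl ⟨rfl, rfl⟩)⟩
        · exact ⟨_, h, pairInd_ne_zero.2 (Or.inr ⟨rfl, rfl⟩)⟩
      rw [finsum_eq_single _ (⟨p, hp⟩ : F)]
      · exact ((zmod_two_cases _).resolve_left hpab).symm
      · rintro ⟨q, hq⟩ hqp
        by_contra hne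
        have hpD := hF p hp
        have hqD := hF q hq
        obtain ⟨p1, p2⟩ := p
        obtain ⟨q1, q2⟩ := q
        rcases pairInd_ne_zero.1 hpab with ⟨rfl, rfl⟩ | ⟨rfl, rfl⟩ <;>
          rcases pairInd_ne_zero.1 hne with ⟨h1, h2⟩ | ⟨h1, h2⟩ <;> simp only at h1 h2 <;>
          subst h1 h2
        · exact hqp rfl
        · exact hD.asymm hpD hqD
        · exact hD.asymm hpD hqD
        · exact hqp rfl
    · have h0 : pairsInd F a b = 0 := by_contra fun h' => h (pairsInd_ne_zero.1 h')
      rw [h0, finsum_eq_zero_of_forall_eq_zero]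
      rintro ⟨⟨u, v⟩, hp⟩
      by_contra hne
      rcases pairInd_ne_zero.1 hne with ⟨rfl, rfl⟩ | ⟨rfl, rfl⟩
      · exact h (Or.inl hp)
      · exact h (Or.inr hp)
  · intro p
    set g : V → V → ZMod 2 := fun a b => ∑ᶠ q, if r q p then pairInd q.1.1 q.1.2 a b else 0
      with hg
    have hg0 : ∀ a b, (∀ q, r q p → pairInd q.1.1 q.1.2 a b = 0) → g a b = 0 := by
      intro a b h
      refine finsum_eq_zero_of_forall_eq_zero fun q => ?_
      split_ifs with hq
      · exact h q hq
      · rfl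
    have hgs : ∀ a b, g a b = g b a := fun a b => by
      simp only [hg, pairInd_symm _ _ a b]
    refine hConn.flip (hD.swapBy hgs) ?_ (fun m n hmn => hQd _ _ fun h => hmn (congrArg Prod.snd h))
      fun n => hConn.congr ?_ (hSC p _ (hQS (p, n)))
    · refine (swapBy_adj_zero (hg0 _ _ fun q hq => ?_)).2 (hF _ p.2)
      by_contra hne
      rcases pairInd_ne_zero.1 hne with ⟨h1, h2⟩ | ⟨h1, h2⟩
      · have : p = q := Subtype.ext (Prod.ext h1 h2)
        exact absurd ((hr _ _).1 hq) (this ▸ lt_irrefl _)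
      · have h3 := hF _ p.2
        rw [h1, h2] at h3
        exact hD.asymm h3 (hF _ q.2)
    · intro a b hab
      refine (swapBy_adj_zero (hg0 _ _ fun q hq => ?_)).symm
      by_contra hne
      obtain ⟨m, hm⟩ := hk q
      have hd := (hQ (q, m) (p, n) (by rw [hm]; exact lt_of_lt_of_le ((hr _ _).1 hq) (hk' p n))).2
      simp only [Finset.disjoint_insert_left, Finset.disjoint_singleton_left] at hd
      rcases pairInd_ne_zero.1 hne with ⟨rfl, rfl⟩ | ⟨rfl, rfl⟩ <;> tauto
  · intro a b
    exact ((hone a b).union ((huniq a).union (huniq b))).subset fun p hp => hp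

/-! ### Rays -/

section ray

open Relation

/-- `R` contains all in-neighbours of its elements. -/
def InClosed {V : Type*} (D : Digraph V) (R : Set V) : Prop :=
  ∀ x y, y ∈ R → D.Adj x y → x ∈ R

/-- The induction step of Kőnig's lemma. The first step of all paths towards `x` that avoid `Z` is
into one of finitely many in-neighbours, whence one of these is reached from infinitely many
vertices without meeting the others. -/
theorem exists_inNbhd_infinite {V : Type u} {D : Digraph V} {Z : Set V} {x : V}
    (hfin : (inNbhd D x).Finite)
    (hinf : {y | ReflTransGen (fun a b => D.Adj a b ∧ a ∉ Z) y x}.Infinite) :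
    ∃ x', D.Adj x' x ∧ x' ∉ Z ∧ {y | ReflTransGen
      (fun a b => D.Adj a b ∧ a ∉ Z ∪ inNbhd D x \ {x'} ∪ {x}) y x'}.Infinite := by
  have claim : ∀ y, ReflTransGen (fun a b => D.Adj a b ∧ a ∉ Z) y x → y = x ∨
      ∃ x', (D.Adj x' x ∧ x' ∉ Z) ∧
        ReflTransGen (fun a b => D.Adj a b ∧ a ∉ Z ∪ inNbhd D x \ {x'} ∪ {x}) y x' := by
    intro y hy
    induction hy using ReflTransGen.head_induction_on with
    | refl => exact Or.inl rfl
    | @head a b hab _ ih =>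
      by_cases hax : a = x
      · exact Or.inl hax
      · by_cases had : D.Adj a x
        · exact Or.inr ⟨a, ⟨had, hab.2⟩, ReflTransGen.refl⟩
        · rcases ih with rfl | ⟨x', hx', h⟩
          · exact absurd hab.1 had
          · refine Or.inr ⟨x', hx', h.head ⟨hab.1, ?_⟩⟩
            rintro ((h1 | h1) | h1)
            exacts [hab.2 h1, had h1.1, hax h1]
  by_contra! hcon
  have hN : {x' | D.Adj x' x ∧ x' ∉ Z}.Finite := hfin.subset fun _ h => h.1
  refine hinf (((Set.finite_singleton x).union (hN.biUnion
    fun x' hx' => hcon x' hx'.1 hx'.2)).subset fun y hy => ?_)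
  rcases claim y hy with h | ⟨x', hx', h⟩
  · exact Or.inl h
  · exact Or.inr (Set.mem_biUnion (s := {x' | D.Adj x' x ∧ x' ∉ Z}) hx' h)

/-- Kőnig's lemma for directed paths to `v`. The additional property that no `x n` with `n ≥ 2` is an
in-neighbour of `x 0` is obtained by forbidding, after each step, the in-neighbours that were not
chosen. -/
theorem exists_ray {V : Type u} {D : Digraph V} (hD : ∀ v, ¬ D.Adj v v)
    (hfin : ∀ v, (inNbhd D v).Finite) {v : V}
    (hinf : {y | ReflTransGen D.Adj y v}.Infinite) :
    ∃ x : ℕ → V, x 0 = v ∧ Function.Injective x ∧ (∀ n, D.Adj (x (n + 1)) (x n)) ∧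
      ∀ n, ¬ D.Adj (x (n + 2)) (x 0) := by
  -- the current vertex and the set of vertices that must not be used any more
  let State := {s : V × Set V //
    {y | ReflTransGen (fun a b => D.Adj a b ∧ a ∉ s.2) y s.1}.Infinite}
  have hstep : ∀ s : State, ∃ t : State, D.Adj t.1.1 s.1.1 ∧ t.1.1 ∉ s.1.2 ∧
      t.1.2 = s.1.2 ∪ inNbhd D s.1.1 \ {t.1.1} ∪ {s.1.1} := by
    rintro ⟨⟨x, Z⟩, h⟩
    obtain ⟨x', h1, h2, h3⟩ := exists_inNbhd_infinite (hfin x) h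
    exact ⟨⟨⟨x', _⟩, h3⟩, h1, h2, rfl⟩
  choose next hn1 hn2 hn3 using hstep
  let σ : ℕ → State := fun n => n.rec ⟨(v, ∅), by simpa using hinf⟩ fun _ s => next s
  let x : ℕ → V := fun n => (σ n).1.1
  let Z : ℕ → Set V := fun n => (σ n).1.2
  have hZ : ∀ n, Z (n + 1) = Z n ∪ inNbhd D (x n) \ {x (n + 1)} ∪ {x n} := fun n => hn3 (σ n)
  have hadj : ∀ n, D.Adj (x (n + 1)) (x n) := fun n => hn1 (σ n)
  have hmono : Monotone Z := monotone_nat_of_le_succ fun n => by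
    rw [hZ]; exact fun a ha => Or.inl (Or.inl ha)
  have hxm : ∀ n, x n ∈ Z (n + 1) := fun n => by
    rw [hZ]; exact Or.inr rfl
  have hx1 : ∀ n, x (n + 1) ∉ Z n := fun n => hn2 (σ n)
  have hx : ∀ m n, m < n → x m ≠ x n := by
    intro m n hmn h
    obtain ⟨n, rfl⟩ : ∃ k, n = k + 1 := ⟨n - 1, by omega⟩
    rcases Nat.lt_or_ge m n with h1 | h1
    · exact hx1 n (h ▸ hmono (Nat.succ_le_of_lt h1) (hxm m))
    · have : m = n := by omega
      subst this
      exact hD _ (h ▸ hadj m)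
  have hinj : Function.Injective x := by
    intro m n h
    rcases lt_trichotomy m n with h1 | h1 | h1
    · exact absurd h (hx m n h1)
    · exact h1
    · exact absurd h.symm (hx n m h1)
  refine ⟨x, rfl, hinj, hadj, fun n h => ?_⟩
  have h1 : x (n + 2) ∈ Z 1 := by
    have h2 := hZ 0
    rw [zero_add] at h2
    rw [h2]
    exact Or.inl (Or.inr ⟨h, fun h' =>
      hx 1 (n + 2) (by omega) (Set.mem_singleton_iff.1 h').symm⟩)
  exact hx1 (n + 1) (hmono (by omega : 1 ≤ n + 1) h1)

section reverseRay

variable {V : Type u} {D : Digraph V} {x : ℕ → V}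

theorem finite_ray_pairs (hx : Function.Injective x) (a b : V) :
    {i | pairInd (x i) (x (i + 1)) a b ≠ 0}.Finite := by
  have h1 : {i | x i = a}.Finite :=
    Set.Subsingleton.finite fun i hi j hj => hx (hi.trans hj.symm)
  have h2 : {i | x i = b}.Finite :=
    Set.Subsingleton.finite fun i hi j hj => hx (hi.trans hj.symm)
  refine (h1.union h2).subset fun i hi => ?_
  rcases pairInd_ne_zero.1 hi with ⟨rfl, -⟩ | ⟨-, rfl⟩
  · exact Or.inl rfl
  · exact Or.inr rfl

/-- A path from infinity to `x 0` can be reversed by successively reversing triangles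
`x 0 → x (k + 2) → x (k + 1) → x 0`, provided that `x 0 → x n` for all `n ≥ 2`. -/
theorem achieves_ray (hx : Function.Injective x)
    (hadj : ∀ n, D.Adj (x (n + 1)) (x n)) (h0 : ∀ n, D.Adj (x 0) (x (n + 2))) :
    Achieves D (fun a b => a ∈ Set.range x ∧ b ∈ Set.range x)
      (fun a b => ∑ᶠ i, pairInd (x i) (x (i + 1)) a b) := by
  let S : ℕ → V → V → ZMod 2 := fun k =>
    ∑ i ∈ Finset.range (k + 1), pairInd (x i) (x (i + 1)) + pairInd (x 0) (x (k + 1))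
  have hS : ∀ k, S (k + 1) + S k =
      pairInd (x 0) (x (k + 2)) + pairInd (x (k + 2)) (x (k + 1)) +
        pairInd (x (k + 1)) (x 0) := by
    intro k
    funext a b
    simp only [S, Finset.sum_range_succ _ (k + 1), Pi.add_apply]
    rw [pairInd_comm (x (k + 2)), pairInd_comm (x (k + 1)) (x 0)]
    linear_combination zmod_two_add_self
      ((∑ i ∈ Finset.range (k + 1), pairInd (x i) (x (i + 1))) a b)
  have hzero : ∀ i m n, (m = i ∧ n = i + 1) ∨ (m = i + 1 ∧ n = i) ∨
      pairInd (x i) (x (i + 1)) (x m) (x n) = 0 := by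
    intro i m n
    by_contra! h
    rcases pairInd_ne_zero.1 h.2.2 with ⟨h1, h2⟩ | ⟨h1, h2⟩
    · exact h.1 (hx h1) (hx h2)
    · exact h.2.1 (hx h1) (hx h2)
  have key := Achieves.concat_nat (D := D)
    (T := fun k a b => ∃ i, pairInd ((![x 0, x (k + 2), x (k + 1)] : Fin 3 → V) i)
      (![x 0, x (k + 2), x (k + 1)] (i + 1)) a b ≠ 0) S
    (fun a b => ∑ᶠ i, pairInd (x i) (x (i + 1)) a b) ?_ ?_ ?_ ?_
  · refine key.mono ?_
    rintro a b ⟨n, i, hi⟩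
    rw [pairInd_ne_zero] at hi
    fin_cases i <;> rcases hi with ⟨rfl, rfl⟩ | ⟨rfl, rfl⟩ <;> exact ⟨⟨_, rfl⟩, ⟨_, rfl⟩⟩
  · funext a b
    simp only [S, zero_add, Finset.range_one, Finset.sum_singleton, Pi.add_apply]
    exact zmod_two_add_self _
  · intro k
    rw [hS]
    have e1 : ∀ i, (swapBy D (S k)).Adj
        ((![x 0, x (k + 2), x (k + 1)] : Fin 3 → V) i) (![x 0, x (k + 2), x (k + 1)] (i + 1)) := by
      intro i
      fin_cases i
      · refine (swapBy_adj_zero ?_).2 (h0 k)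
        simp only [S, Pi.add_apply]
        rw [pairInd_eq_zero (by simp [hx.eq_iff]), add_zero, Finset.sum_apply, Finset.sum_apply]
        refine Finset.sum_eq_zero fun i hi => ?_
        rcases hzero i 0 (k + 2) with h | h | h
        · omega
        · omega
        · exact h
      · refine (swapBy_adj_zero ?_).2 (hadj (k + 1))
        simp only [S, Pi.add_apply]
        rw [pairInd_eq_zero (by simp [hx.eq_iff]), add_zero, Finset.sum_apply, Finset.sum_apply]
        refine Finset.sum_eq_zero fun i hi => ?_
        have := Finset.mem_range.1 hi
        rcases hzero i (k + 2) (k + 1) with h | h | h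
        · omega
        · omega
        · exact h
      · change (swapBy D (S k)).Adj (x (k + 1)) (x 0)
        rcases k with _ | k
        · refine (swapBy_adj_zero ?_).2 (hadj 0)
          simp only [S, zero_add, Finset.range_one, Finset.sum_singleton, Pi.add_apply]
          exact zmod_two_add_self _
        · refine (swapBy_adj_one ?_).2 (h0 k)
          simp only [S, Pi.add_apply]
          rw [Finset.sum_apply, Finset.sum_apply, Finset.sum_eq_zero, zero_add]
          · exact pairInd_ne_zero.2 (Or.inr ⟨rfl, rfl⟩)
          · intro i hi
            rcases hzero i (k + 1 + 1) 0 with h | h | h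
            · omega
            · omega
            · exact h
    have i1 : Function.Injective (![x 0, x (k + 2), x (k + 1)] : Fin 3 → V) := by
      simp only [injective_vecCons_iff, Fin.forall_fin_succ]
      simp [hx.eq_iff, Function.injective_of_subsingleton]
    have := achieves_cycle i1 e1
    rwa [Fin.sum_univ_three] at this
  · intro a b
    have h1 : ∀ (c : V) (j : ℕ), {k | c = x (k + j)}.Finite := fun c j =>
      Set.Subsingleton.finite fun m hm n hn => by
        have := hx (hm.symm.trans hn)
        omega
    refine (((h1 a 1).union (h1 a 2)).union ((h1 b 1).union (h1 b 2))).subset ?_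
    rintro k ⟨i, hi⟩
    rw [pairInd_ne_zero] at hi
    fin_cases i <;> simp at hi <;> simp <;> tauto
  · intro a b
    have h1 : ∀ (c : V), {k | c = x (k + 1)}.Finite := fun c =>
      Set.Subsingleton.finite fun m hm n hn => by
        have := hx (hm.symm.trans hn)
        omega
    obtain ⟨N, hN⟩ := ((finite_ray_pairs hx a b).union ((h1 a).union (h1 b))).bddAbove
    refine ⟨N + 1, fun n hn => ?_⟩
    rw [finsum_eq_sum_of_support_subset (s := Finset.range (n + 1))]
    · simp only [S, Pi.add_apply, Finset.sum_apply]
      rw [pairInd_eq_zero, add_zero]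
      rintro (⟨-, h⟩ | ⟨h, -⟩)
      · have := hN (Or.inr (Or.inr h) : n ∈ _)
        omega
      · have := hN (Or.inr (Or.inl h) : n ∈ _)
        omega
    · intro i hi
      have := hN (Or.inl hi)
      simp only [Finset.coe_range, Set.mem_Iio]
      omega

end reverseRay

/-! ### Countable tournaments with finite in-degrees -/

theorem InClosed.swapBy {V : Type u} {D : Digraph V} {R : Set V} (h : InClosed D R)
    {f : V → V → ZMod 2} (hf : ∀ a b, b ∈ R → f a b = 0) : InClosed (swapBy D f) R :=
  fun x y hy hxy => h x y hy ((swapBy_adj_zero (hf x y hy)).1 hxy)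

/-- The in-neighbours of one vertex can be reduced until it is reached from finitely many vertices
only. Each ray leading to `v` that is reversed takes away an in-neighbour of `v`. -/
theorem exists_finite_inClosed {V : Type u} {v : V} {R : Set V} (hR : R.Finite) (n : ℕ)
    (D : Digraph V) (hD : IsTournament D) (hfin : ∀ v, (inNbhd D v).Finite)
    (hRD : InClosed D R) (hn : (inNbhd D v).ncard = n) :
    ∃ f, Achieves D (fun a b => a ∉ R ∧ b ∉ R) f ∧ (∀ v, (inNbhd (swapBy D f) v).Finite) ∧
      ∃ R' : Set V, R'.Finite ∧ R ⊆ R' ∧ v ∈ R' ∧ InClosed (swapBy D f) R' := by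
  induction n using Nat.strong_induction_on generalizing D with
  | _ n ih =>
  by_cases hinf : {y | ReflTransGen D.Adj y v}.Finite
  · refine ⟨0, achieves_zero _ _, by simpa using hfin, R ∪ {y | ReflTransGen D.Adj y v},
      hR.union hinf, fun _ h => Or.inl h, Or.inr ReflTransGen.refl, ?_⟩
    rw [swapBy_zero']
    rintro x y (hy | hy) hxy
    · exact Or.inl (hRD x y hy hxy)
    · exact Or.inr (ReflTransGen.head hxy hy)
  · obtain ⟨x, rfl, hx, hadj, hx0⟩ := exists_ray hD.1 hfin hinf
    have hf := achieves_ray hx hadj fun n =>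
      hD.adj_of_not (fun h => by have := hx h; omega) (hx0 n)
    set f : V → V → ZMod 2 := fun a b => ∑ᶠ i, pairInd (x i) (x (i + 1)) a b with hfdef
    have hfne : ∀ a b, f a b ≠ 0 → ∃ i, (a = x i ∧ b = x (i + 1)) ∨ (a = x (i + 1) ∧ b = x i) := by
      intro a b h
      by_contra! hcon
      refine h (finsum_eq_zero_of_forall_eq_zero fun i => pairInd_eq_zero ?_)
      have := hcon i
      tauto
    have hf10 : f (x 1) (x 0) ≠ 0 := by
      have : f (x 1) (x 0) = pairInd (x 0) (x 1) (x 1) (x 0) := by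
        refine finsum_eq_single _ 0 fun i hi => pairInd_eq_zero ?_
        rintro (⟨h1, h2⟩ | ⟨h1, h2⟩)
        · have := hx h2; omega
        · exact hi (hx h2).symm
      rw [this]
      exact pairInd_ne_zero.2 (Or.inr ⟨rfl, rfl⟩)
    -- the ray avoids `R`, since otherwise its tail would lie in the finite set `R`
    have hxR : ∀ n, x n ∉ R := by
      intro n hn
      have h1 : ∀ k, x (n + k) ∈ R := by
        intro k
        induction k with
        | zero => exact hn
        | succ k ihk => exact hRD _ _ ihk (hadj _)
      exact Set.infinite_of_injective_forall_mem
        (fun a b hab => by have := hx hab; omega) h1 hR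
    have hfR : ∀ a b, b ∈ R → f a b = 0 := by
      intro a b hb
      by_contra h
      obtain ⟨i, ⟨-, rfl⟩ | ⟨-, rfl⟩⟩ := hfne a b h <;> exact hxR _ hb
    have hsub : inNbhd (swapBy D f) (x 0) ⊆ inNbhd D (x 0) \ {x 1} := by
      intro w hw
      by_cases hw0 : f w (x 0) = 0
      · exact ⟨(swapBy_adj_zero hw0).1 hw, fun h => hf10 (h ▸ hw0)⟩
      · exfalso
        obtain ⟨i, ⟨-, h⟩ | ⟨rfl, h⟩⟩ := hfne _ _ hw0
        · have := hx h; omega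
        · have hi := hx h
          subst hi
          exact hD.asymm (hadj 0) ((swapBy_adj_one hw0).1 hw)
    have hlt : (inNbhd (swapBy D f) (x 0)).ncard < n := by
      rw [← hn]
      refine Set.ncard_lt_ncard ⟨hsub.trans Set.sdiff_subset, fun h => ?_⟩ (hfin _)
      exact (hsub (h (hadj 0))).2 rfl
    have hfin' : ∀ v, (inNbhd (swapBy D f) v).Finite := by
      intro v
      have h1 : {i | v = x i}.Finite :=
        Set.Subsingleton.finite fun i hi j hj => hx (hi.symm.trans hj)
      refine ((hfin v).union ((h1.image fun i => x (i + 1)).union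
        (h1.image fun i => x (i - 1)))).subset fun w hw => ?_
      by_cases hw0 : f w v = 0
      · exact Or.inl ((swapBy_adj_zero hw0).1 hw)
      · obtain ⟨i, ⟨rfl, rfl⟩ | ⟨rfl, rfl⟩⟩ := hfne _ _ hw0
        · exact Or.inr (Or.inr ⟨i + 1, rfl, by simp⟩)
        · exact Or.inr (Or.inl ⟨i, rfl, rfl⟩)
    obtain ⟨g, hg, hg1, R', h1, h2, h3, h4⟩ := ih _ hlt (swapBy D f) (hD.swapBy hf.symm) hfin'
      (hRD.swapBy hfR) rfl
    rw [swapBy_swapBy _ hf.symm] at hg1 h4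
    refine ⟨f + g, (hf.trans hg).mono ?_, hg1, R', h1, h2, h3, h4⟩
    rintro a b (⟨⟨i, rfl⟩, ⟨j, rfl⟩⟩ | h)
    · exact ⟨hxR i, hxR j⟩
    · exact h

/-- In a countable tournament with finite in-degrees, vertices are treated one after the other,
keeping the finite sets of vertices from which the earlier ones are reached untouched. -/
theorem exists_achieves_inClosed_finite {V : Type u} [Countable V] {D : Digraph V}
    (hD : IsTournament D) (hfin : ∀ v, (inNbhd D v).Finite) :
    ∃ f, Achieves D (fun _ _ => True) f ∧
      ∀ v, ∃ R : Set V, R.Finite ∧ v ∈ R ∧ InClosed (swapBy D f) R := by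
  rcases isEmpty_or_nonempty V with hV | hV
  · exact ⟨0, achieves_zero _ _, fun v => hV.elim v⟩
  obtain ⟨enum, henum⟩ := exists_surjective_nat V
  -- the pairs exchanged so far and the set of vertices that must not be touched any more
  let State := {s : (V → V → ZMod 2) × Set V // (∀ a b, s.1 a b = s.1 b a) ∧
    (∀ v, (inNbhd (swapBy D s.1) v).Finite) ∧ s.2.Finite ∧ InClosed (swapBy D s.1) s.2}
  have hstep : ∀ (n : ℕ) (s : State), ∃ t : State, s.1.2 ⊆ t.1.2 ∧ enum n ∈ t.1.2 ∧
      Achieves (swapBy D s.1.1) (fun a b => a ∉ s.1.2 ∧ b ∉ s.1.2) (t.1.1 + s.1.1) := by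
    rintro n ⟨⟨S, R⟩, h1, h2, h3, h4⟩
    obtain ⟨f, hf, hf1, R', k1, k2, k3, k4⟩ := exists_finite_inClosed (v := enum n) h3 _ _
      (hD.swapBy h1) h2 h4 rfl
    rw [swapBy_swapBy _ h1] at hf1 k4
    refine ⟨⟨(S + f, R'), fun a b => ?_, hf1, k1, k4⟩, k2, k3, ?_⟩
    · simp only [Pi.add_apply]
      exact congrArg₂ _ (h1 a b) (hf.symm a b)
    · have : S + f + S = f := by
        funext a b
        simp only [Pi.add_apply]
        linear_combination zmod_two_add_self (S a b)
      simpa only [this] using hf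
  choose next hn1 hn2 hn3 using hstep
  let σ : ℕ → State := fun n => n.rec ⟨(0, ∅), fun _ _ => rfl, by simpa using hfin,
    Set.finite_empty, fun _ _ h => h.elim⟩ fun n s => next n s
  let S : ℕ → V → V → ZMod 2 := fun n => (σ n).1.1
  let R : ℕ → Set V := fun n => (σ n).1.2
  have hmono : Monotone R := monotone_nat_of_le_succ fun n => hn1 n (σ n)
  have hmem : ∀ n, enum n ∈ R (n + 1) := fun n => hn2 n (σ n)
  have hach : ∀ n, Achieves (swapBy D (S n)) (fun a b => a ∉ R n ∧ b ∉ R n)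
      (S (n + 1) + S n) := fun n => hn3 n (σ n)
  have hSs : ∀ n a b, S n a b = S n b a := fun n => (σ n).2.1
  have hRfin : ∀ n, (R n).Finite := fun n => (σ n).2.2.2.1
  have hRcl : ∀ n, InClosed (swapBy D (S n)) (R n) := fun n => (σ n).2.2.2.2
  have hconst : ∀ N a b, a ∈ R N → ∀ n, N ≤ n → S n a b = S N a b := by
    intro N a b ha n hn
    induction n, hn using Nat.le_induction with
    | base => rfl
    | succ n hn ih =>
      rw [← ih]
      by_contra hne
      have h1 : (S (n + 1) + S n) a b ≠ 0 := by
        intro h0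
        apply hne
        rw [Pi.add_apply, Pi.add_apply] at h0
        linear_combination h0 - zmod_two_add_self (S n a b)
      exact ((hach n).ne_zero h1).1 (hmono hn ha)
  choose idx hidx using henum
  have hRi : ∀ a, a ∈ R (idx a + 1) := fun a => by
    have := hmem (idx a)
    rwa [hidx] at this
  let S' : V → V → ZMod 2 := fun a b => S (idx a + 1) a b
  have hS' : ∀ N a b, b ∈ R N → S' a b = S N a b := by
    intro N a b hb
    have h1 := hconst _ a b (hRi a) (max N (idx a + 1)) (le_max_right _ _)
    have h2 := hconst _ b a hb (max N (idx a + 1)) (le_max_left _ _)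
    rw [hSs, hSs N] at h2
    exact h1.symm.trans h2
  have key := Achieves.concat_nat (D := D) S S' rfl hach ?_ ?_
  · refine ⟨S', key.mono fun _ _ _ => trivial, fun v => ⟨R (idx v + 1), hRfin (idx v + 1), hRi v, ?_⟩⟩
    intro x y hy hxy
    exact hRcl (idx v + 1) x y hy ((swapBy_adj_congr (hS' (idx v + 1) x y hy)).1 hxy)
  · intro a b
    refine (Set.finite_le_nat (idx a + 1)).subset fun n hn => ?_
    by_contra hlt
    exact hn.1 (hmono (not_le.1 hlt).le (hRi a))
  · intro a b
    exact ⟨idx a + 1, hconst _ a b (hRi a)⟩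

end ray

/-! ### A criterion for small strong components -/

/-- Every vertex has fewer than `κ` in-neighbours in `A` and fewer than `κ` out-neighbours in `Aᶜ`. In
the model case `A` is an initial part of order type `κ` of a linear order, and `Aᶜ` is a final part
of the reverse order type. -/
def IsSplit {V : Type u} (κ : Cardinal.{u}) (D : Digraph V) (A : Set V) : Prop :=
  ∀ v, #{w | w ∈ A ∧ D.Adj w v} < κ ∧ #{w | w ∉ A ∧ D.Adj v w} < κ

/-- `Y` contains the in-neighbours in `A` and the out-neighbours in `Aᶜ` of its elements. -/
def IsSplitClosed {V : Type u} (D : Digraph V) (A Y : Set V) : Prop :=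
  ∀ v ∈ Y, ∀ w, (w ∈ A → D.Adj w v → w ∈ Y) ∧ (w ∉ A → D.Adj v w → w ∈ Y)

/-- No arc leads from `P` to its complement, every vertex of `P` lies in a set of size less than `κ`
that contains all its in-neighbours in `P`, and dually for the complement of `P`. -/
structure IsGood {V : Type u} (κ : Cardinal.{u}) (D : Digraph V) (P : Set V) : Prop where
  cut : ∀ a ∈ P, ∀ b, b ∉ P → ¬ D.Adj a b
  inside : ∀ v ∈ P, ∃ S : Set V, v ∈ S ∧ #S < κ ∧ ∀ x ∈ P, ∀ y ∈ S, D.Adj x y → x ∈ S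
  outside : ∀ v, v ∉ P → ∃ S : Set V, v ∈ S ∧ #S < κ ∧ ∀ x, x ∉ P → ∀ y ∈ S, D.Adj y x → x ∈ S

theorem mk_union_lt {V : Type u} {κ : Cardinal.{u}} (hκ : ℵ₀ ≤ κ) {S T : Set V} (hS : #S < κ)
    (hT : #T < κ) : #(S ∪ T : Set V) < κ :=
  (mk_union_le S T).trans_lt (add_lt_of_lt hκ hS hT)

/-- No arc leads from `A ∪ L` to its complement: one from `L` would contradict closedness, one from
`A` has an end in `L`. -/
theorem isGood_of_isSplitClosed {V : Type u} {κ : Cardinal.{u}} (hκ : ℵ₀ ≤ κ) {D : Digraph V}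
    {A L : Set V} (hL : IsSplitClosed D A L) (hLκ : #L < κ)
    (hcov : ∀ a ∈ A, ∀ b, b ∉ A → D.Adj a b → a ∈ L ∨ b ∈ L)
    (hv : ∀ v, ∃ Y : Set V, IsSplitClosed D A Y ∧ v ∈ Y ∧ #Y < κ) : IsGood κ D (A ∪ L) where
  cut := by
    rintro a ha b hb hab
    simp only [Set.mem_union, not_or] at hb
    rcases ha with ha | ha
    · rcases hcov a ha b hb.1 hab with h | h
      · exact hb.2 ((hL a h b).2 hb.1 hab)
      · exact hb.2 h
    · exact hb.2 ((hL a ha b).2 hb.1 hab)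
  inside := by
    intro v _
    obtain ⟨Y, hY, hvY, hYκ⟩ := hv v
    refine ⟨Y ∪ L, Or.inl hvY, mk_union_lt hκ hYκ hLκ, ?_⟩
    rintro x (hx | hx) y (hy | hy) hxy
    · exact Or.inl ((hY y hy x).1 hx hxy)
    · exact Or.inr ((hL y hy x).1 hx hxy)
    · exact Or.inr hx
    · exact Or.inr hx
  outside := by
    intro v _
    obtain ⟨Y, hY, hvY, hYκ⟩ := hv v
    refine ⟨Y, hvY, hYκ, fun x hx y hy hyx => (hY y hy x).2 (fun h => hx (Or.inl h)) hyx⟩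

theorem IsGood.subset_or_subset {V : Type u} {κ : Cardinal.{u}} {D : Digraph V} {P : Set V}
    (h : IsGood κ D P) {S : Set V} (hS : IsStrong (induced D S)) : S ⊆ P ∨ S ⊆ Pᶜ := by
  by_cases hP : ∃ a ∈ S, a ∈ P
  · obtain ⟨a, haS, haP⟩ := hP
    left
    intro b hbS
    by_cases hab : a = b
    · exact hab ▸ haP
    · have hpath := hS ⟨a, haS⟩ ⟨b, hbS⟩ fun h => hab (congrArg Subtype.val h)
      have : ∀ c : S, Relation.TransGen (induced D S).Adj ⟨a, haS⟩ c → (c : V) ∈ P := by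
        intro c hc
        induction hc with
        | single h1 => exact by_contra fun h2 => h.cut _ haP _ h2 h1
        | tail _ h1 ih => exact by_contra fun h2 => h.cut _ ih _ h2 h1
      exact this _ hpath
  · right
    exact fun b hb hbP => hP ⟨b, hb, hbP⟩

/-- A strong set is contained in any of the sets `S` from the definition of `IsGood` that it meets
on its side of the cut. -/
theorem IsGood.mk_lt_of_isStrong {V : Type u} {κ : Cardinal.{u}} (hκ : ℵ₀ ≤ κ) {D : Digraph V}
    {P : Set V} (h : IsGood κ D P) {S : Set V} (hS : IsStrong (induced D S)) : #S < κ := by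
  rcases S.eq_empty_or_nonempty with rfl | ⟨v, hv⟩
  · simpa using aleph0_pos.trans_le hκ
  rcases h.subset_or_subset hS with hSP | hSP
  · obtain ⟨Y, hvY, hY, hcl⟩ := h.inside v (hSP hv)
    refine (mk_le_mk_of_subset fun w hw => ?_).trans_lt hY
    by_cases hwv : w = v
    · exact hwv ▸ hvY
    · have hpath := hS ⟨w, hw⟩ ⟨v, hv⟩ fun h => hwv (congrArg Subtype.val h)
      have : ∀ c : S, Relation.TransGen (induced D S).Adj c ⟨v, hv⟩ → (c : V) ∈ Y := by
        intro c hc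
        induction hc using Relation.TransGen.head_induction_on with
        | single h1 => exact hcl _ (hSP (Subtype.prop _)) _ hvY h1
        | head h1 _ ih => exact hcl _ (hSP (Subtype.prop _)) _ ih h1
      exact this _ hpath
  · obtain ⟨Y, hvY, hY, hcl⟩ := h.outside v (hSP hv)
    refine (mk_le_mk_of_subset fun w hw => ?_).trans_lt hY
    by_cases hwv : v = w
    · exact hwv ▸ hvY
    · have hpath := hS ⟨v, hv⟩ ⟨w, hw⟩ fun h => hwv (congrArg Subtype.val h)
      have : ∀ c : S, Relation.TransGen (induced D S).Adj ⟨v, hv⟩ c → (c : V) ∈ Y := by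
        intro c hc
        induction hc with
        | single h1 => exact hcl _ (hSP (Subtype.prop _)) _ hvY h1
        | tail _ h1 ih => exact hcl _ (hSP (Subtype.prop _)) _ ih h1
      exact this _ hpath

/-! ### Reversing or covering the arcs of a cut -/

theorem exists_maximal_matching {V : Type u} (B : Set (V × V)) :
    ∃ M ⊆ B, (∀ p ∈ M, ∀ q ∈ M, p ≠ q → p.1 ≠ q.1 ∧ p.2 ≠ q.2) ∧
      ∀ p ∈ B, ∃ q ∈ M, p.1 = q.1 ∨ p.2 = q.2 := by
  obtain ⟨M, hM⟩ := zorn_subset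
    {M : Set (V × V) | M ⊆ B ∧ ∀ p ∈ M, ∀ q ∈ M, p ≠ q → p.1 ≠ q.1 ∧ p.2 ≠ q.2} (by
      intro c hc hchain
      refine ⟨⋃₀ c, ⟨Set.sUnion_subset fun M hM => (hc hM).1, ?_⟩,
        fun M hM => Set.subset_sUnion_of_mem hM⟩
      rintro p ⟨M, hM, hp⟩ q ⟨N, hN, hq⟩ hpq
      rcases hchain.total hM hN with h | h
      · exact (hc hN).2 p (h hp) q hq hpq
      · exact (hc hM).2 p hp q (h hq) hpq)
  refine ⟨M, hM.prop.1, hM.prop.2, fun p hp => ?_⟩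
  by_contra! hcon
  have hins : insert p M ∈
      {M : Set (V × V) | M ⊆ B ∧ ∀ p ∈ M, ∀ q ∈ M, p ≠ q → p.1 ≠ q.1 ∧ p.2 ≠ q.2} := by
    refine ⟨Set.insert_subset hp hM.prop.1, ?_⟩
    rintro q (rfl | hq) r (rfl | hr) hqr
    · exact absurd rfl hqr
    · exact hcon r hr
    · exact ⟨(hcon q hq).1.symm, (hcon q hq).2.symm⟩
    · exact hM.prop.2 q hq r hr hqr
  exact (hcon p (hM.le_of_ge hins (Set.subset_insert _ _) (Set.mem_insert _ _))).1 rfl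

/-- Either fewer than `κ` vertices meet all arcs from `A` to `Aᶜ`, or there are `κ` disjoint such
arcs. In the second case all arcs from `A` to `Aᶜ` can be reversed: for such an arc `ab`, most of the
disjoint arcs `a'b'` yield a path `b → a' → b' → a`. -/
theorem exists_achieves_cover {V : Type u} {κ : Cardinal.{u}} (hκ : ℵ₀ ≤ κ) (hV : #V ≤ κ)
    {D : Digraph V} (hD : IsTournament D) {A : Set V} (hA : IsSplit κ D A) :
    ∃ f, Achieves D (fun _ _ => True) f ∧ IsSplit κ (swapBy D f) A ∧ ∃ W : Set V, #W < κ ∧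
      ∀ a ∈ A, ∀ b, b ∉ A → (swapBy D f).Adj a b → a ∈ W ∨ b ∈ W := by
  classical
  obtain ⟨M, hMB, hMd, hMmax⟩ :=
    exists_maximal_matching {p : V × V | p.1 ∈ A ∧ p.2 ∉ A ∧ D.Adj p.1 p.2}
  rcases lt_or_ge #M κ with hMκ | hMκ
  · refine ⟨0, achieves_zero _ _, by rwa [swapBy_zero'], Prod.fst '' M ∪ Prod.snd '' M,
      mk_union_lt hκ (mk_image_le.trans_lt hMκ) (mk_image_le.trans_lt hMκ), ?_⟩
    rw [swapBy_zero']
    intro a ha b hb hab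
    obtain ⟨q, hq, h | h⟩ := hMmax (a, b) ⟨ha, hb, hab⟩
    · exact Or.inl (Or.inl ⟨q, hq, h.symm⟩)
    · exact Or.inr (Or.inr ⟨q, hq, h.symm⟩)
  set B : Set (V × V) := {p : V × V | p.1 ∈ A ∧ p.2 ∉ A ∧ D.Adj p.1 p.2} with hB
  have hBD : ∀ p ∈ B, D.Adj p.1 p.2 := fun p hp => hp.2.2
  obtain ⟨e, he, heκ⟩ := exists_key_of_mk_le (F := B) hκ
    ((mk_set_le B).trans (by rw [← mul_def]; exact mul_le_of_le hκ hV hV))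
  let M' : B → Set (V × V) := fun p => {q | q ∈ M ∧ D.Adj p.1.2 q.1 ∧ D.Adj q.2 p.1.1}
  have hM' : ∀ p, κ ≤ #(M' p) := by
    intro p
    by_contra! hlt
    have h1 : #{q | q ∈ M ∧ ¬ D.Adj p.1.2 q.1} < κ := by
      refine lt_of_le_of_lt ?_ (hA p.1.2).1
      refine mk_le_of_injective (f := fun q => ⟨q.1.1, (hMB q.2.1).1, ?_⟩) ?_
      · exact hD.adj_of_not (fun h => p.2.2.1 (h ▸ (hMB q.2.1).1)) q.2.2
      · intro q r hqr
        by_contra hne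
        exact (hMd _ q.2.1 _ r.2.1 fun h => hne (Subtype.ext h)).1 (congrArg Subtype.val hqr)
    have h2 : #{q | q ∈ M ∧ ¬ D.Adj q.2 p.1.1} < κ := by
      refine lt_of_le_of_lt ?_ (hA p.1.1).2
      refine mk_le_of_injective (f := fun q => ⟨q.1.2, (hMB q.2.1).2.1, ?_⟩) ?_
      · exact hD.adj_of_not (fun h => (hMB q.2.1).2.1 (h.symm ▸ p.2.1)) q.2.2
      · intro q r hqr
        by_contra hne
        exact (hMd _ q.2.1 _ r.2.1 fun h => hne (Subtype.ext h)).2 (congrArg Subtype.val hqr)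
    refine hMκ.not_gt ((mk_le_mk_of_subset fun q hq => ?_).trans_lt
      (mk_union_lt hκ hlt (mk_union_lt hκ h1 h2)))
    by_cases h3 : D.Adj p.1.2 q.1
    · by_cases h4 : D.Adj q.2 p.1.1
      · exact Or.inl ⟨hq, h3, h4⟩
      · exact Or.inr (Or.inr ⟨hq, h4⟩)
    · exact Or.inr (Or.inl ⟨hq, h3⟩)
  have hdisj : ∀ q ∈ M, ∀ r ∈ M, q ≠ r → Disjoint ({q.1, q.2} : Finset V) {r.1, r.2} := by
    intro q hq r hr hqr
    have h1 := hMd q hq r hr hqr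
    have h2 : q.1 ≠ r.2 := fun h => (hMB hr).2.1 (h ▸ (hMB hq).1)
    have h3 : q.2 ≠ r.1 := fun h => (hMB hq).2.1 (h ▸ (hMB hr).1)
    simp [h1.1.symm, h1.2.symm, h2.symm, h3.symm]
  let S : B → Set (Finset V) := fun p => (fun q : V × V => ({q.1, q.2} : Finset V)) '' M' p
  have hS : ∀ p, κ ≤ #(S p) := by
    intro p
    rw [mk_image_eq_of_injOn]
    · exact hM' p
    · intro q hq r hr hqr
      by_contra hne
      have := hdisj q hq.1 r hr.1 hne
      simp only at hqr
      rw [hqr, Finset.disjoint_self_iff_empty] at this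
      simp at this
  have key := achieves_pairsInd hD hBD isFlipping_isThreePath he (S := S) ?_
    (fun p => hκ.trans (hS p)) (fun x => (heκ x).trans_le (hS x.1)) ?_
  · refine ⟨_, key, ?_, ∅, by simpa using aleph0_pos.trans_le hκ, ?_⟩
    · intro v
      refine ⟨(mk_le_mk_of_subset fun w hw => ?_).trans_lt (hA v).1,
        (mk_le_mk_of_subset fun w hw => ?_).trans_lt (hA v).2⟩
      · rcases (swapBy_pairsInd_adj hD hBD _ _).1 hw.2 with h | h
        · exact ⟨hw.1, h.1⟩
        · exact absurd hw.1 h.2.1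
      · rcases (swapBy_pairsInd_adj hD hBD _ _).1 hw.2 with h | h
        · exact ⟨hw.1, h.1⟩
        · exact absurd h.1 hw.1
    · intro a ha b hb hab
      rcases (swapBy_pairsInd_adj hD hBD _ _).1 hab with h | h
      · exact absurd ⟨ha, hb, h.1⟩ h.2
      · exact absurd ha h.2.1
  · rintro p _ ⟨q, hq, rfl⟩ _ ⟨r, hr, rfl⟩ hne
    exact hdisj q hq.1 r hr.1 fun h => hne (by rw [h])
  · rintro p _ ⟨q, hq, rfl⟩
    exact ⟨q.1, q.2, by congr, hq.2.1, (hMB hq.1).2.2, hq.2.2⟩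

/-! ### Successor cardinals -/

theorem mk_iUnion_le_of_le {V ι : Type u} {ν : Cardinal.{u}} (hν : ℵ₀ ≤ ν) {s : ι → Set V}
    (hι : #ι ≤ ν) (hs : ∀ i, #(s i) ≤ ν) : #(⋃ i, s i) ≤ ν :=
  mk_iUnion_le_sum_mk.trans <| (sum_le_sum _ (fun _ => ν) hs).trans <| by
    rw [sum_const']; exact mul_le_of_le hν hι le_rfl

/-- The closure of a set is a union of countably many sets of size at most `ν`. -/
theorem exists_isSplitClosed_of_succ {V : Type u} {ν : Cardinal.{u}} (hν : ℵ₀ ≤ ν)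
    {D : Digraph V} {A : Set V} (hA : IsSplit (Order.succ ν) D A) {X : Set V}
    (hX : #X < Order.succ ν) :
    ∃ Y : Set V, X ⊆ Y ∧ IsSplitClosed D A Y ∧ #Y < Order.succ ν := by
  simp only [IsSplit, Order.lt_succ_iff] at hA hX ⊢
  let N : V → Set V := fun v => {w | w ∈ A ∧ D.Adj w v} ∪ {w | w ∉ A ∧ D.Adj v w}
  have hN : ∀ v, #(N v) ≤ ν := fun v =>
    (mk_union_le _ _).trans (add_le_of_le hν (hA v).1 (hA v).2)
  let Y : ℕ → Set V := fun n => n.rec X fun _ Y => Y ∪ ⋃ v : (Y : Set V), N v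
  have hY : ∀ n, #(↥(Y n)) ≤ ν := by
    intro n
    induction n with
    | zero => exact hX
    | succ n ih =>
      exact (mk_union_le _ _).trans
        (add_le_of_le hν ih (mk_iUnion_le_of_le hν ih fun v => hN v))
  refine ⟨⋃ n : ULift.{u} ℕ, Y n.down, Set.subset_iUnion_of_subset ⟨0⟩ subset_rfl, ?_,
    mk_iUnion_le_of_le hν (by simpa using hν) fun n => hY n.down⟩
  intro v hv w
  obtain ⟨⟨n⟩, hn⟩ := Set.mem_iUnion.1 hv
  have : ∀ w, w ∈ N v → w ∈ ⋃ n : ULift.{u} ℕ, Y n.down := fun w hw =>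
    Set.mem_iUnion.2 ⟨⟨n + 1⟩, Or.inr (Set.mem_iUnion.2 ⟨⟨v, hn⟩, hw⟩)⟩
  exact ⟨fun h1 h2 => this w (Or.inl ⟨h1, h2⟩), fun h1 h2 => this w (Or.inr ⟨h1, h2⟩)⟩

/-! ### The countable case -/

/-- Within `A` each vertex is made reachable from finitely many vertices only, and dually in `Aᶜ`. Only
finitely many arcs lead from `A` to `Aᶜ`, and these are not changed. -/
theorem exists_isGood_of_countable {V : Type u} [Countable V] {D : Digraph V}
    (hD : IsTournament D) {A : Set V} (hA : IsSplit ℵ₀ D A) {W : Set V} (hW : #W < ℵ₀)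
    (hcov : ∀ a ∈ A, ∀ b, b ∉ A → D.Adj a b → a ∈ W ∨ b ∈ W) :
    ∃ f, Achieves D (fun _ _ => True) f ∧ ∃ P, IsGood ℵ₀ (swapBy D f) P := by
  simp only [IsSplit, lt_aleph0_iff_set_finite] at hA hW
  obtain ⟨f, hf, hfR⟩ := exists_achieves_inClosed_finite (hD.induced A) fun v =>
    ((hA v).1.preimage Subtype.val_injective.injOn).subset fun w hw => ⟨w.2, hw⟩
  obtain ⟨g, hg, hgR⟩ := exists_achieves_inClosed_finite (hD.induced Aᶜ).dual fun v =>
    ((hA v).2.preimage Subtype.val_injective.injOn).subset fun w hw => ⟨w.2, hw⟩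
  have hg' : Achieves (induced D Aᶜ) (fun _ _ => True) g := hg.dual
  have hF := hf.of_induced
  have hind : induced (swapBy D (extendPairs A f)) Aᶜ = induced D Aᶜ := by
    ext a b
    exact swapBy_adj_zero (extendPairs_of_not f fun h => a.2 h.1)
  rw [← hind] at hg'
  have hFG := hF.trans hg'.of_induced
  set h : V → V → ZMod 2 := extendPairs A f + extendPairs Aᶜ g with hdef
  have hcross : ∀ a b, (a ∈ A ∧ b ∉ A) ∨ (a ∉ A ∧ b ∈ A) →
      ((swapBy D h).Adj a b ↔ D.Adj a b) := by
    intro a b hab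
    refine swapBy_adj_zero ?_
    rw [hdef, Pi.add_apply, Pi.add_apply, extendPairs_of_not, extendPairs_of_not, add_zero]
    · rintro ⟨h1, h2⟩
      exact hab.elim (fun h => h1 h.1) fun h => h2 h.2
    · rintro ⟨h1, h2⟩
      exact hab.elim (fun h => h.2 h2) fun h => h.1 h1
  have hinA : ∀ a b : A, (swapBy D h).Adj a b ↔ (swapBy (induced D A) f).Adj a b := by
    intro a b
    have : h a b = f a b := by
      rw [hdef, Pi.add_apply, Pi.add_apply, extendPairs_of_mem, extendPairs_of_not, add_zero]
      exact fun h => h.1 a.2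
    simp [swapBy, this, induced]
  have hinB : ∀ a b : (Aᶜ : Set V), (swapBy D h).Adj a b ↔
      (swapBy (dual (induced D Aᶜ)) g).Adj b a := by
    intro a b
    have : h a b = g b a := by
      rw [hdef, Pi.add_apply, Pi.add_apply, extendPairs_of_mem (X := Aᶜ),
        extendPairs_of_not, zero_add,
        hg.symm]
      exact fun h => a.2 h.1
    simp [swapBy, this, induced, dual]
  have hR : ∀ v, ∃ R : Set V, R.Finite ∧ v ∈ R ∧ ∀ y ∈ R,
      (y ∈ A → ∀ x ∈ A, (swapBy D h).Adj x y → x ∈ R) ∧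
      (y ∉ A → ∀ x, x ∉ A → (swapBy D h).Adj y x → x ∈ R) := by
    intro v
    by_cases hv : v ∈ A
    · obtain ⟨R, h1, h2, h3⟩ := hfR ⟨v, hv⟩
      refine ⟨Subtype.val '' R, h1.image _, ⟨_, h2, rfl⟩, ?_⟩
      rintro _ ⟨y, hy, rfl⟩
      exact ⟨fun _ x hx hxy => ⟨⟨x, hx⟩, h3 _ _ hy ((hinA ⟨x, hx⟩ y).1 hxy), rfl⟩,
        fun h => absurd y.2 h⟩
    · obtain ⟨R, h1, h2, h3⟩ := hgR ⟨v, hv⟩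
      refine ⟨Subtype.val '' R, h1.image _, ⟨_, h2, rfl⟩, ?_⟩
      rintro _ ⟨y, hy, rfl⟩
      exact ⟨fun h => absurd h y.2,
        fun _ x hx hxy => ⟨⟨x, hx⟩, h3 _ _ hy ((hinB y ⟨x, hx⟩).1 hxy), rfl⟩⟩
  choose R hRfin hRmem hRcl using hR
  -- the end vertices of the arcs from `A` to its complement
  let E : Set V := {v | (v ∈ A ∧ ∃ b, b ∉ A ∧ D.Adj v b) ∨ (v ∉ A ∧ ∃ a ∈ A, D.Adj a v)}
  have hE : E.Finite := by
    refine (hW.union (hW.biUnion fun w _ => (hA w).1.union (hA w).2)).subset ?_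
    rintro v (⟨hv, b, hb, hvb⟩ | ⟨hv, a, ha, hav⟩)
    · rcases hcov v hv b hb hvb with h | h
      · exact Or.inl h
      · exact Or.inr (Set.mem_biUnion h (Or.inl ⟨hv, hvb⟩))
    · rcases hcov a ha v hv hav with h | h
      · exact Or.inr (Set.mem_biUnion h (Or.inr ⟨hv, hav⟩))
      · exact Or.inl h
  have hclosed : ∀ U : Set V, E ⊆ U → IsSplitClosed (swapBy D h) A (⋃ u ∈ U, R u) := by
    intro U hU v hv w
    obtain ⟨u, hu, hvu⟩ := Set.mem_iUnion₂.1 hv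
    refine ⟨fun hw hwv => ?_, fun hw hvw => ?_⟩
    · by_cases hvA : v ∈ A
      · exact Set.mem_biUnion hu ((hRcl u v hvu).1 hvA w hw hwv)
      · exact Set.mem_biUnion (hU (Or.inl ⟨hw, v, hvA, (hcross w v (Or.inl ⟨hw, hvA⟩)).1 hwv⟩))
          (hRmem w)
    · by_cases hvA : v ∈ A
      · exact Set.mem_biUnion (hU (Or.inr ⟨hw, v, hvA, (hcross v w (Or.inl ⟨hvA, hw⟩)).1 hvw⟩))
          (hRmem w)
      · exact Set.mem_biUnion hu ((hRcl u v hvu).2 hvA w hw hvw)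
  refine ⟨h, hFG.mono fun _ _ _ => trivial, A ∪ ⋃ u ∈ E, R u,
    isGood_of_isSplitClosed le_rfl (hclosed E subset_rfl)
      (lt_aleph0_iff_set_finite.2 (hE.biUnion fun u _ => hRfin u)) ?_ fun v => ?_⟩
  · intro a ha b hb hab
    exact Or.inl (Set.mem_biUnion
      (show a ∈ E from Or.inl ⟨ha, b, hb, (hcross a b (Or.inl ⟨ha, hb⟩)).1 hab⟩) (hRmem a))
  · exact ⟨⋃ u ∈ insert v E, R u, hclosed _ (Set.subset_insert _ _),
      Set.mem_biUnion (Set.mem_insert _ _) (hRmem v),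
      lt_aleph0_iff_set_finite.2 ((hE.insert v).biUnion fun u _ => hRfin u)⟩

/-! ### Limit cardinals -/

theorem mk_le_succ_of_key {X : Type u} {ν : Cardinal.{u}} {ξ : X → Ordinal.{u}}
    (hξ : Function.Injective ξ) (h : ∀ x, (ξ x).card ≤ ν) : #X ≤ Order.succ ν := by
  have h1 : ∀ x, ξ x ∈ Set.Iio (Order.succ ν).ord := fun x =>
    lt_ord.2 (Order.lt_succ_iff.2 (h x))
  rw [← mk_ord_toType (Order.succ ν)]
  refine mk_le_of_injective (f := fun x => Ordinal.ToType.mk ⟨ξ x, h1 x⟩) fun x y hxy => ?_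
  exact hξ (congrArg Subtype.val (Ordinal.ToType.mk.injective hxy))

/-- Few vertices of a tournament have small in-degree: if there were more than `μ⁺` vertices of
in-degree at most `μ`, then one of them would not be among the in-neighbours of `μ⁺` others, and would
have all of these as in-neighbours. -/
theorem mk_inDegree_le {V : Type u} {D : Digraph V} (hD : IsTournament D) (A : Set V)
    {μ : Cardinal.{u}} (hμ : ℵ₀ ≤ μ) :
    #{v | v ∈ A ∧ #{w | w ∈ A ∧ D.Adj w v} ≤ μ} ≤ Order.succ μ := by
  by_contra! hlt
  set X := {v | v ∈ A ∧ #{w | w ∈ A ∧ D.Adj w v} ≤ μ} with hX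
  have hμ' : ℵ₀ ≤ Order.succ μ := hμ.trans (Order.le_succ μ)
  obtain ⟨Y, hYX, hY⟩ := le_mk_iff_exists_subset.1 hlt.le
  have hN : #(Y ∪ ⋃ y : Y, {w | w ∈ A ∧ D.Adj w y} : Set V) ≤ Order.succ μ :=
    (mk_union_le _ _).trans (add_le_of_le hμ' hY.le
      (mk_iUnion_le_of_le hμ' hY.le fun y => (hYX y.2).2.trans (Order.le_succ μ)))
  obtain ⟨x, hxX, hx⟩ : ∃ x ∈ X, x ∉ (Y ∪ ⋃ y : Y, {w | w ∈ A ∧ D.Adj w y} : Set V) := by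
    by_contra! hcon
    exact (hlt.trans_le (mk_le_mk_of_subset hcon)).not_ge hN
  simp only [Set.mem_union, Set.mem_iUnion, not_or, not_exists] at hx
  have hle : Y ⊆ {w | w ∈ A ∧ D.Adj w x} := fun y hy =>
    ⟨(hYX hy).1, hD.adj_of_not (fun h => hx.1 (h ▸ hy)) fun h => hx.2 ⟨y, hy⟩ ⟨hxX.1, h⟩⟩
  have := (mk_le_mk_of_subset hle).trans hxX.2
  rw [hY] at this
  exact (Order.lt_succ μ).not_ge this

/-- Ranks, as used in `exists_key_of_rank`, for the arcs `wv` with `w ∈ A` and `a v < a w`, where `a v`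
bounds the in-degree of `v` from `A`; there will be `a w` paths of length two from `v` to `w`. The rank of `wv` is `a v` whenever `v` is one of the few vertices in `A`
or in `W` with that value; otherwise it comes from enumerating the out-neighbours of `w` in `Aᶜ`. -/
theorem exists_rank {V : Type u} {D : Digraph V} (hD : IsTournament D) {A W : Set V}
    {l : Cardinal.{u}} (hl : ℵ₀ ≤ l) (hW : #W ≤ l)
    (hcov : ∀ w ∈ A, ∀ v, v ∉ A → D.Adj w v → w ∈ W ∨ v ∈ W) {a b : V → Cardinal.{u}}
    (ha : ∀ v, #{w | w ∈ A ∧ D.Adj w v} ≤ a v) (hb : ∀ w, #{v | v ∉ A ∧ D.Adj w v} ≤ b w)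
    (hla : ∀ v, l ≤ a v) (hba : ∀ w ∈ A, b w ≤ a w) (hal : ∀ v, v ∉ A → v ∉ W → a v = l) :
    ∃ ρ : V × V → Cardinal.{u},
      (∀ p : V × V, p.1 ∈ A ∧ D.Adj p.1 p.2 ∧ a p.2 < a p.1 → l ≤ ρ p ∧ ρ p < a p.1) ∧
      ∀ ν, #{p : V × V | (p.1 ∈ A ∧ D.Adj p.1 p.2 ∧ a p.2 < a p.1) ∧ ρ p = ν} ≤ Order.succ ν := by
  classical
  have hkey : ∀ w, ∃ ξ : V → Ordinal.{u}, w ∈ A →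
      Set.InjOn ξ {v | v ∉ A ∧ D.Adj w v} ∧ ∀ v ∈ {v | v ∉ A ∧ D.Adj w v}, (ξ v).card < a w := by
    intro w
    by_cases hw : w ∈ A
    · obtain ⟨e, he, hlt⟩ := exists_key_of_mk_le (F := {v | v ∉ A ∧ D.Adj w v})
        (hl.trans (hla w)) ((hb w).trans (hba w hw))
      refine ⟨fun v => if h : v ∉ A ∧ D.Adj w v then e (⟨v, h⟩, 0) else 0, fun _ => ⟨?_, ?_⟩⟩
      · intro u hu v hv huv
        have hu' : u ∉ A ∧ D.Adj w u := hu
        have hv' : v ∉ A ∧ D.Adj w v := hv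
        simp only [hu', hv', not_false_eq_true, and_self, dite_true] at huv
        simpa using he huv
      · intro v hv
        have hv' : v ∉ A ∧ D.Adj w v := hv
        simp only [hv', not_false_eq_true, and_self, dite_true]
        exact hlt _
    · exact ⟨fun _ => 0, fun h => absurd h hw⟩
  choose ξ hξ using hkey
  refine ⟨fun p => if p.2 ∈ A ∨ p.2 ∈ W then a p.2 else max l (ξ p.1 p.2).card, ?_, ?_⟩
  · rintro ⟨w, v⟩ ⟨hw, hwv, hlt⟩
    by_cases hv : v ∈ A ∨ v ∈ W
    · simpa only [hv, if_true] using ⟨hla v, hlt⟩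
    · simp only [hv, if_false]
      simp only [not_or] at hv
      refine ⟨le_max_left _ _, max_lt ?_ ((hξ w hw).2 v ⟨hv.1, hwv⟩)⟩
      rw [← hal v hv.1 hv.2]
      exact hlt
  · intro ν
    rcases lt_or_ge ν l with hν | hν
    · refine le_of_eq_of_le ?_ zero_le
      rw [mk_eq_zero_iff]
      refine ⟨fun ⟨p, hp⟩ => hν.not_ge ?_⟩
      rw [← hp.2]
      beta_reduce
      split_ifs with h
      · exact hla _
      · exact le_max_left _ _
    have hν0 : ℵ₀ ≤ ν := hl.trans hν
    have hν' : ℵ₀ ≤ Order.succ ν := hν0.trans (Order.le_succ ν)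
    let Y : Set V := {v | v ∈ A ∧ #{w | w ∈ A ∧ D.Adj w v} ≤ ν} ∪ W
    have hY : #Y ≤ Order.succ ν := (mk_union_le _ _).trans
      (add_le_of_le hν' (mk_inDegree_le hD A hν0) (hW.trans (hν.trans (Order.le_succ ν))))
    have h1 : #(⋃ v : Y, {p : V × V | (p.1 ∈ A ∧ D.Adj p.1 v) ∧ p.2 = v ∧ a v ≤ ν}) ≤
        Order.succ ν := by
      refine mk_iUnion_le_of_le hν' hY fun v => ?_
      by_cases hv : a v ≤ ν
      · refine le_trans ?_ (((ha v).trans hv).trans (Order.le_succ ν))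
        refine mk_le_of_injective (f := fun p => ⟨p.1.1, p.2.1⟩) fun p q hpq => ?_
        exact Subtype.ext (Prod.ext (congrArg Subtype.val hpq) (p.2.2.1.trans q.2.2.1.symm))
      · refine le_of_eq_of_le ?_ zero_le
        rw [mk_eq_zero_iff]
        exact ⟨fun p => hv p.2.2.2⟩
    have h2 : #(⋃ w : W, {p : V × V | p.1 = w ∧ p.1 ∈ A ∧ (p.2 ∉ A ∧ D.Adj p.1 p.2) ∧
        (ξ p.1 p.2).card ≤ ν}) ≤ Order.succ ν := by
      refine mk_iUnion_le_of_le hν' (hW.trans (hν.trans (Order.le_succ ν))) fun w => ?_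
      refine mk_le_succ_of_key (ξ := fun p => ξ w p.1.2) (fun p q hpq => ?_) fun p => ?_
      · have hmem : ∀ p : {p : V × V | p.1 = w ∧ p.1 ∈ A ∧ (p.2 ∉ A ∧ D.Adj p.1 p.2) ∧
            (ξ p.1 p.2).card ≤ ν}, p.1.2 ∈ {v | v ∉ A ∧ D.Adj w v} := fun p =>
          ⟨p.2.2.2.1.1, (congrArg (D.Adj · _) p.2.1).mp p.2.2.2.1.2⟩
        have hw : (w : V) ∈ A := (congrArg (· ∈ A) p.2.1).mp p.2.2.1
        exact Subtype.ext (Prod.ext (p.2.1.trans q.2.1.symm)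
          ((hξ w hw).1 (hmem p) (hmem q) hpq))
      · have := p.2.2.2.2
        rwa [p.2.1] at this
    refine (mk_le_mk_of_subset ?_).trans ((mk_union_le _ _).trans (add_le_of_le hν' h1 h2))
    rintro ⟨w, v⟩ ⟨⟨hw, hwv, -⟩, hρ⟩
    simp only at hw hwv hρ
    split_ifs at hρ with hv
    · refine Or.inl (Set.mem_iUnion.2 ⟨⟨v, ?_⟩, ⟨hw, hwv⟩, rfl, hρ.le⟩)
      rcases hv with hv | hv
      · exact Or.inl ⟨hv, (ha v).trans hρ.le⟩
      · exact Or.inr hv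
    · simp only [not_or] at hv
      have hwW : w ∈ W := (hcov w hw v hv.1 hwv).resolve_right hv.2
      exact Or.inr (Set.mem_iUnion.2 ⟨⟨w, hwW⟩, rfl, hw, ⟨hv.1, hwv⟩,
        (le_max_right _ _).trans hρ.le⟩)

/-- Most of the `a w` in-neighbours of `w` in `A` are out-neighbours of `v`, because `v` has fewer than
`a w` in-neighbours in `A`. -/
theorem le_mk_two_paths {V : Type u} {D : Digraph V} (hD : IsTournament D) {A : Set V}
    {l : Cardinal.{u}} (hl : ℵ₀ ≤ l) {a : V → Cardinal.{u}}
    (ha : ∀ v, a v = max #{w | w ∈ A ∧ D.Adj w v} l) {v w : V} (hvw : a v < a w) :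
    a w ≤ #{z | D.Adj v z ∧ D.Adj z w} := by
  have hla : ∀ v, l ≤ a v := fun v => (ha v).symm ▸ le_max_right _ _
  have h0 : ℵ₀ ≤ a w := hl.trans (hla w)
  have h1 : a w = #{z | z ∈ A ∧ D.Adj z w} := by
    rcases max_choice #{z | z ∈ A ∧ D.Adj z w} l with h | h
    · rw [ha w, h]
    · have := hvw
      rw [ha w, h] at this
      exact absurd (hla v) this.not_ge
  by_contra! hlt
  have h2 : #{z | z ∈ A ∧ D.Adj z v} < a w :=
    lt_of_le_of_lt (by rw [ha v]; exact le_max_left _ _) hvw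
  have h3 : #({v} : Set V) < a w := by
    rw [mk_singleton]; exact one_lt_aleph0.trans_le h0
  refine (h1.le.trans (mk_le_mk_of_subset fun z hz => ?_)).not_gt
    (mk_union_lt h0 hlt (mk_union_lt h0 h2 h3))
  by_cases hzv : z = v
  · exact Or.inr (Or.inr hzv)
  · by_cases h : D.Adj z v
    · exact Or.inr (Or.inl ⟨hz.1, h⟩)
    · exact Or.inl ⟨hD.adj_of_not hzv h, hz.2⟩

/-- The case of a limit cardinal, for a set `A` chosen such that `a v = max α l` bounds `b v = max β l`
for `v ∈ A` and is smaller for other `v`, where `α` and `β` are the numbers of in-neighbours in `A`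
and of out-neighbours in `Aᶜ`. All arcs that lead into a set `{v | max (a v) (b v) ≤ μ}` from a vertex
of `A` outside it, or out of such a set to a vertex of `Aᶜ` outside it, are reversed, and so are the
arcs from `A` to `Aᶜ` except those with both ends in the smallest of these sets. -/
theorem exists_isGood_of_balanced {V : Type u} {κ : Cardinal.{u}} (hκ : ℵ₀ ≤ κ)
    (hlim : ∀ μ < κ, Order.succ μ < κ) {D : Digraph V} (hD : IsTournament D) {A W : Set V}
    {l : Cardinal.{u}} (hl : ℵ₀ ≤ l) (hlκ : l < κ) (hW : #W ≤ l)
    (hcov : ∀ w ∈ A, ∀ v, v ∉ A → D.Adj w v → w ∈ W ∨ v ∈ W) {a b : V → Cardinal.{u}}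
    (ha : ∀ v, a v = max #{w | w ∈ A ∧ D.Adj w v} l)
    (hb : ∀ v, b v = max #{w | w ∉ A ∧ D.Adj v w} l)
    (haκ : ∀ v, a v < κ) (hbκ : ∀ v, b v < κ) (hba : ∀ v ∈ A, b v ≤ a v)
    (hab : ∀ v, v ∉ A → a v < b v ∨ (a v = l ∧ b v = l))
    (hal : ∀ v, v ∉ A → v ∉ W → a v = l) (hbl : ∀ v ∈ A, v ∉ W → b v = l) :
    ∃ f, Achieves D (fun _ _ => True) f ∧ ∃ P, IsGood κ (swapBy D f) P := by
  classical
  have hla : ∀ v, l ≤ a v := fun v => (ha v).symm ▸ le_max_right _ _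
  have hlb : ∀ v, l ≤ b v := fun v => (hb v).symm ▸ le_max_right _ _
  have hab' : ∀ v, v ∉ A → a v ≤ b v := fun v hv =>
    (hab v hv).elim le_of_lt fun h => (h.1.trans h.2.symm).le
  have hb' : ∀ v, b v = max #{w | w ∈ Aᶜ ∧ (dual D).Adj w v} l := hb
  have ha1 : ∀ v, #{w | w ∈ A ∧ D.Adj w v} ≤ a v := fun v => by
    rw [ha]; exact le_max_left _ _
  have hb1 : ∀ v, #{w | w ∉ A ∧ D.Adj v w} ≤ b v := fun v => by
    rw [hb]; exact le_max_left _ _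
  obtain ⟨ρ, hρ, hρν⟩ := exists_rank hD hl hW hcov ha1 hb1 hla hba hal
  obtain ⟨ρ', hρ', hρν'⟩ := exists_rank hD.dual (A := Aᶜ) hl hW
    (fun w hw v hv hwv => (hcov v (not_not.1 hv) w hw hwv).symm) (a := b) (b := a) hb1
    (fun w => by
      refine (mk_le_mk_of_subset fun v hv => ?_).trans (ha1 w)
      exact ⟨not_not.1 hv.1, hv.2⟩)
    hlb hab' (fun v hv => hbl v (not_not.1 hv))
  let F₁ : Set (V × V) := {p | p.1 ∈ A ∧ D.Adj p.1 p.2 ∧ a p.2 < a p.1}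
  let F₂ : Set (V × V) := {p | p.2 ∉ A ∧ D.Adj p.1 p.2 ∧ b p.1 < b p.2}
  have hFD : ∀ p ∈ F₁ ∪ F₂, D.Adj p.1 p.2 := by
    rintro p (hp | hp) <;> exact hp.2.1
  let r : (F₁ ∪ F₂ : Set (V × V)) → Cardinal.{u} := fun p =>
    if p.1 ∈ F₁ then ρ p.1 else ρ' p.1.swap
  have hr2 : ∀ p : (F₁ ∪ F₂ : Set (V × V)), p.1 ∉ F₁ → l ≤ ρ' p.1.swap ∧ ρ' p.1.swap < b p.1.2 :=
    fun p hp => hρ' p.1.swap (p.2.resolve_left hp)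
  have hrl : ∀ p, l ≤ r p := by
    intro p
    simp only [r]
    split_ifs with hp
    · exact (hρ p.1 hp).1
    · exact (hr2 p hp).1
  have hconn : ∀ p, r p < #{z | D.Adj p.1.2 z ∧ D.Adj z p.1.1} := by
    intro p
    simp only [r]
    split_ifs with hp
    · exact (hρ p.1 hp).2.trans_le (le_mk_two_paths hD hl ha hp.2.2)
    · refine (hr2 p hp).2.trans_le ((le_mk_two_paths hD.dual hl hb'
        (p.2.resolve_left hp).2.2).trans (mk_le_mk_of_subset fun z hz => ⟨hz.2, hz.1⟩))
  obtain ⟨e, he, her⟩ := exists_key_of_rank r (fun p => hl.trans (hrl p)) (by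
    intro ν hν
    have h1 := mk_union_le
      {p : V × V | (p.1 ∈ A ∧ D.Adj p.1 p.2 ∧ a p.2 < a p.1) ∧ ρ p = ν}
      {p : V × V | p.swap ∈
        {p : V × V | (p.1 ∈ Aᶜ ∧ (dual D).Adj p.1 p.2 ∧ b p.2 < b p.1) ∧ ρ' p = ν}}
    rw [← mk_image_eq (f := (Subtype.val : (F₁ ∪ F₂ : Set (V × V)) → V × V))
      Subtype.val_injective]
    refine (mk_le_mk_of_subset ?_).trans
      (h1.trans (add_le_of_le (hν.trans (Order.le_succ ν)) (hρν ν)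
        ((mk_preimage_of_injective _ _ Prod.swap_injective).trans (hρν' ν))))
    rintro _ ⟨p, h2, rfl⟩
    simp only [r, Set.mem_ofPred_eq] at h2
    split_ifs at h2 with hp
    · exact Or.inl ⟨hp, h2⟩
    · exact Or.inr ⟨p.2.resolve_left hp, h2⟩)
  let S : (F₁ ∪ F₂ : Set (V × V)) → Set (Finset V) := fun p =>
    (fun z => {z}) '' {z | D.Adj p.1.2 z ∧ D.Adj z p.1.1}
  have hS : ∀ p, #(S p) = #{z | D.Adj p.1.2 z ∧ D.Adj z p.1.1} := fun p =>
    mk_image_eq Finset.singleton_injective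
  have key := achieves_pairsInd hD hFD isFlipping_isTwoPath he (S := S) ?_
    (fun p => by rw [hS]; exact (hl.trans (hrl p)).trans (hconn p).le)
    (fun x => by rw [hS, her]; exact hconn x.1) ?_
  rotate_left
  · rintro p _ ⟨x, -, rfl⟩ _ ⟨y, -, rfl⟩ hne
    exact Finset.disjoint_singleton.2 fun h => hne (by rw [h])
  · rintro p _ ⟨x, hx, rfl⟩
    exact ⟨x, rfl, hx⟩
  refine ⟨_, key, ?_⟩
  set D' := swapBy D (pairsInd (F₁ ∪ F₂))
  have hD' : ∀ x y, D'.Adj x y ↔ (D.Adj x y ∧ (x, y) ∉ F₁ ∪ F₂) ∨ (y, x) ∈ F₁ ∪ F₂ :=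
    swapBy_pairsInd_adj hD hFD
  let L : Cardinal.{u} → Set V := fun μ => {v | a v ≤ μ ∧ b v ≤ μ}
  have hLcl : ∀ μ, IsSplitClosed D' A (L μ) := by
    intro μ v hv w
    constructor
    · intro hw hwv
      by_contra hwL
      have hlt : μ < a w := by
        by_contra! h
        exact hwL ⟨h, (hba w hw).trans h⟩
      rcases (hD' w v).1 hwv with h | h | h
      · exact h.2 (Or.inl ⟨hw, h.1, hv.1.trans_lt hlt⟩)
      · exact (hv.1.trans_lt hlt).not_gt h.2.2
      · exact h.1 hw
    · intro hw hvw
      by_contra hwL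
      have hlt : μ < b w := by
        by_contra! h
        exact hwL ⟨(hab' w hw).trans h, h⟩
      rcases (hD' v w).1 hvw with h | h | h
      · exact h.2 (Or.inr ⟨hw, h.1, hv.2.trans_lt hlt⟩)
      · exact hw h.1
      · exact (hv.2.trans_lt hlt).not_gt h.2.2
  have hLκ : ∀ μ, l ≤ μ → μ < κ → #(L μ) < κ := by
    intro μ hlμ hμκ
    have h1 := mk_inDegree_le hD A (hl.trans hlμ)
    have h2 := mk_inDegree_le hD.dual Aᶜ (hl.trans hlμ)
    refine (mk_le_mk_of_subset fun v hv => ?_).trans_lt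
      (mk_union_lt hκ (h1.trans_lt (hlim μ hμκ)) (h2.trans_lt (hlim μ hμκ)))
    by_cases hvA : v ∈ A
    · exact Or.inl ⟨hvA, (ha1 v).trans hv.1⟩
    · exact Or.inr ⟨hvA, (hb1 v).trans hv.2⟩
  refine ⟨A ∪ L l, isGood_of_isSplitClosed hκ (hLcl l) (hLκ l le_rfl hlκ) ?_ fun v =>
    ⟨L (max (a v) (b v)), hLcl _, ⟨le_max_left _ _, le_max_right _ _⟩,
      hLκ _ ((hla v).trans (le_max_left _ _)) (max_lt (haκ v) (hbκ v))⟩⟩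
  intro w hw v hv hwv
  rcases (hD' w v).1 hwv with h | h | h
  · simp only [Set.mem_union, not_or] at h
    have h1 : a w ≤ a v := by
      by_contra! hlt
      exact h.2.1 ⟨hw, h.1, hlt⟩
    have h2 : b v ≤ b w := by
      by_contra! hlt
      exact h.2.2 ⟨hv, h.1, hlt⟩
    rcases hab v hv with h3 | h3
    · exact absurd (h3.trans_le (h2.trans ((hba w hw).trans h1))) (lt_irrefl _)
    · exact Or.inr ⟨h3.1.le, h3.2.le⟩
  · exact absurd h.1 hv
  · exact absurd hw h.1

/-- Moving few vertices between `A` and `Aᶜ` makes the hypotheses of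
`exists_isGood_of_balanced` true. -/
theorem exists_isGood_of_limit {V : Type u} {κ : Cardinal.{u}} (hκ : ℵ₀ < κ)
    (hlim : ∀ μ < κ, Order.succ μ < κ) {D : Digraph V} (hD : IsTournament D) {A W : Set V}
    (hA : IsSplit κ D A) (hW : #W < κ)
    (hcov : ∀ w ∈ A, ∀ v, v ∉ A → D.Adj w v → w ∈ W ∨ v ∈ W) :
    ∃ f, Achieves D (fun _ _ => True) f ∧ ∃ P, IsGood κ (swapBy D f) P := by
  set l : Cardinal.{u} := max ℵ₀ #W with hldef
  have hl : ℵ₀ ≤ l := le_max_left _ _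
  have hWl : #W ≤ l := le_max_right _ _
  have hlκ : l < κ := max_lt hκ hW
  set α : V → Cardinal.{u} := fun v => #{w | w ∈ A ∧ D.Adj w v} with hα
  set β : V → Cardinal.{u} := fun v => #{w | w ∉ A ∧ D.Adj v w} with hβ
  -- the vertices of `W` are distributed anew, so that, after rounding up to `l`, `β v ≤ α v` on `A'`
  -- and the reverse inequality holds off `A'`
  set A' : Set V := {v | (v ∉ W ∧ v ∈ A) ∨ (v ∈ W ∧ β v ≤ α v)} with hA'
  have hAA' : ∀ v, v ∉ W → (v ∈ A' ↔ v ∈ A) := by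
    intro v hv
    simp [hA', hv]
  have hWA' : ∀ v, v ∈ W → (v ∈ A' ↔ β v ≤ α v) := by
    intro v hv
    simp [hA', hv]
  have hmax : ∀ X Y : Set V, X ⊆ Y ∪ W → Y ⊆ X ∪ W → max #X l = max #Y l := by
    have h1 : ∀ X Y : Set V, X ⊆ Y ∪ W → #X ≤ max #Y l := by
      intro X Y h
      refine ((mk_le_mk_of_subset h).trans (mk_union_le _ _)).trans
        (add_le_of_le (hl.trans (le_max_right _ _)) (le_max_left _ _)
          (hWl.trans (le_max_right _ _)))
    exact fun X Y hXY hYX => le_antisymm (max_le (h1 X Y hXY) (le_max_right _ _))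
      (max_le (h1 Y X hYX) (le_max_right _ _))
  have ha : ∀ v, max (α v) l = max #{w | w ∈ A' ∧ D.Adj w v} l := by
    intro v
    apply hmax <;> intro w hw <;> by_cases hwW : w ∈ W
    · exact Or.inr hwW
    · exact Or.inl ⟨(hAA' w hwW).2 hw.1, hw.2⟩
    · exact Or.inr hwW
    · exact Or.inl ⟨(hAA' w hwW).1 hw.1, hw.2⟩
  have hb : ∀ v, max (β v) l = max #{w | w ∉ A' ∧ D.Adj v w} l := by
    intro v
    apply hmax <;> intro w hw <;> by_cases hwW : w ∈ W
    · exact Or.inr hwW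
    · exact Or.inl ⟨fun h => hw.1 ((hAA' w hwW).1 h), hw.2⟩
    · exact Or.inr hwW
    · exact Or.inl ⟨fun h => hw.1 ((hAA' w hwW).2 h), hw.2⟩
  have hβl : ∀ v ∈ A, v ∉ W → β v ≤ l := fun v hv hvW =>
    (mk_le_mk_of_subset fun w hw => (hcov v hv w hw.1 hw.2).resolve_left hvW).trans hWl
  have hαl : ∀ v, v ∉ A → v ∉ W → α v ≤ l := fun v hv hvW =>
    (mk_le_mk_of_subset fun w hw => (hcov w hw.1 v hv hw.2).resolve_right hvW).trans hWl
  refine exists_isGood_of_balanced hκ.le hlim hD hl hlκ hWl (A := A') (W := W) ?_ ha hb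
    (fun v => max_lt (hA v).1 hlκ) (fun v => max_lt (hA v).2 hlκ) ?_ ?_ ?_ ?_
  · intro w hw v hv hwv
    by_contra! h
    rcases hcov w ((hAA' w h.1).1 hw) v (fun h' => hv ((hAA' v h.2).2 h')) hwv with h' | h'
    · exact h.1 h'
    · exact h.2 h'
  · intro v hv
    refine max_le ?_ (le_max_right _ _)
    by_cases hvW : v ∈ W
    · exact ((hWA' v hvW).1 hv).trans (le_max_left _ _)
    · exact (hβl v ((hAA' v hvW).1 hv) hvW).trans (le_max_right _ _)
  · intro v hv
    rcases le_or_gt (β v) l with h | h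
    · right
      refine ⟨max_eq_right ?_, max_eq_right h⟩
      by_cases hvW : v ∈ W
      · exact (not_le.1 fun h' => hv ((hWA' v hvW).2 h')).le.trans h
      · exact hαl v (fun h' => hv ((hAA' v hvW).2 h')) hvW
    · left
      rw [max_eq_left h.le]
      refine max_lt ?_ h
      by_cases hvW : v ∈ W
      · exact not_le.1 fun h' => hv ((hWA' v hvW).2 h')
      · exact (hαl v (fun h' => hv ((hAA' v hvW).2 h')) hvW).trans_lt h
  · exact fun v hv hvW => max_eq_right (hαl v (fun h' => hv ((hAA' v hvW).2 h')) hvW)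
  · exact fun v hv hvW => max_eq_right (hβl v ((hAA' v hvW).1 hv) hvW)

/-! ### Uniform tournaments -/

theorem isSplit_of_isUniform {V : Type u} {κ : Cardinal.{u}} {D : Digraph V}
    (hD : IsTournament D) (h : IsUniform κ D) (v₀ : V) : IsSplit κ D (outNbhd D v₀) := by
  intro v
  refine ⟨(mk_le_mk_of_subset fun w hw => ?_).trans_lt (h v v₀).2,
    (mk_le_mk_of_subset fun w hw => ?_).trans_lt (h v v₀).1⟩
  · exact Or.inl ⟨hw.2, hD.asymm hw.1⟩
  · exact Or.inl ⟨hw.2, hw.1⟩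

theorem exists_isGood_of_isUniform {V : Type u} {κ : Cardinal.{u}} (hκ : ℵ₀ ≤ κ) (hV : #V = κ)
    {D : Digraph V} (hD : IsTournament D) (h : IsUniform κ D) :
    ∃ f, Achieves D (fun _ _ => True) f ∧ ∃ P, IsGood κ (swapBy D f) P := by
  have hne : Nonempty V := mk_ne_zero_iff.1 (hV.symm ▸ (aleph0_pos.trans_le hκ).ne')
  obtain ⟨v₀⟩ := hne
  obtain ⟨f, hf, hA, W, hW, hcov⟩ :=
    exists_achieves_cover hκ hV.le hD (isSplit_of_isUniform hD h v₀)
  suffices hg : ∃ g, Achieves (swapBy D f) (fun _ _ => True) g ∧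
      ∃ P, IsGood κ (swapBy (swapBy D f) g) P by
    obtain ⟨g, hg, P, hP⟩ := hg
    rw [swapBy_swapBy _ hf.symm] at hP
    exact ⟨f + g, (hf.trans hg).mono fun _ _ _ => trivial, P, hP⟩
  have hDf := hD.swapBy hf.symm
  rcases hκ.eq_or_lt with rfl | hκ'
  · have : Countable V := mk_le_aleph0_iff.1 hV.le
    exact exists_isGood_of_countable hDf hA hW hcov
  by_cases hlim : ∀ μ < κ, Order.succ μ < κ
  · exact exists_isGood_of_limit hκ' hlim hDf hA hW hcov
  · push Not at hlim
    obtain ⟨ν, hνκ, hν⟩ := hlim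
    obtain rfl : κ = Order.succ ν := le_antisymm hν (Order.succ_le_of_lt hνκ)
    have hν0 : ℵ₀ ≤ ν := Order.lt_succ_iff.1 hκ'
    obtain ⟨L, hWL, hLcl, hL⟩ := exists_isSplitClosed_of_succ hν0 hA hW
    refine ⟨0, achieves_zero _ _, outNbhd D v₀ ∪ L, ?_⟩
    rw [swapBy_zero']
    refine isGood_of_isSplitClosed hκ hLcl hL (fun a ha b hb hab =>
      (hcov a ha b hb hab).imp (fun h => hWL h) fun h => hWL h) fun v => ?_
    obtain ⟨Y, hvY, hYcl, hY⟩ := exists_isSplitClosed_of_succ hν0 hA (X := {v}) (by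
      rw [mk_singleton]; exact one_lt_aleph0.trans_le hκ)
    exact ⟨Y, hYcl, hvY rfl, hY⟩

/-! ### General tournaments -/

/-- The vertices are sorted by inclusion of out-neighbourhoods up to fewer than `κ` vertices; this
preorder is extended to a linear order on its classes. -/
theorem exists_linear_classes {V : Type u} {κ : Cardinal.{u}} (hκ : ℵ₀ ≤ κ) (D : Digraph V) :
    ∃ (L : Type u) (_ : LinearOrder L) (cls : V → L),
      (∀ u v, #(outNbhd D u \ outNbhd D v : Set V) < κ → cls u ≤ cls v) ∧
      ∀ u v, cls u = cls v → #(outNbhd D u \ outNbhd D v : Set V) < κ := by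
  let P : Preorder V :=
    { le := fun u v => #(outNbhd D u \ outNbhd D v : Set V) < κ
      le_refl := fun u => by simpa using aleph0_pos.trans_le hκ
      le_trans := fun u v w h1 h2 => by
        refine (mk_le_mk_of_subset fun x hx => ?_).trans_lt (mk_union_lt hκ h1 h2)
        by_cases hv : x ∈ outNbhd D v
        · exact Or.inr ⟨hv, hx.2⟩
        · exact Or.inl ⟨hx.1, hv⟩ }
  refine ⟨LinearExtension (Antisymmetrization V (· ≤ ·)), inferInstance,
    fun v => toLinearExtension (toAntisymmetrization (· ≤ ·) v), fun u v h => ?_, fun u v h => ?_⟩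
  · exact toLinearExtension.monotone h
  · have h1 : toAntisymmetrization (α := V) (· ≤ ·) u = toAntisymmetrization (· ≤ ·) v := h
    exact (Quotient.exact h1).1

/-- In a tournament, in-neighbourhoods are complements of out-neighbourhoods up to one vertex, so only
the latter need to be compared. -/
theorem isUniform_induced {V : Type u} {κ : Cardinal.{u}} (hκ : ℵ₀ ≤ κ) {D : Digraph V}
    (hD : IsTournament D) {X : Set V}
    (h : ∀ u ∈ X, ∀ v ∈ X, #(outNbhd D u \ outNbhd D v : Set V) < κ) :
    IsUniform κ (induced D X) := by
  intro u v
  have h1 : #(symmDiff (outNbhd D u) (outNbhd D v) : Set V) < κ :=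
    mk_union_lt hκ (h u u.2 v v.2) (h v v.2 u u.2)
  have h2 : ∀ w : V, #({w} : Set V) < κ := fun w => by
    rw [mk_singleton]; exact one_lt_aleph0.trans_le hκ
  constructor
  · rw [← mk_image_eq (f := (Subtype.val : X → V)) Subtype.val_injective]
    refine (mk_le_mk_of_subset ?_).trans_lt h1
    rintro _ ⟨w, hw | hw, rfl⟩
    · exact Or.inl hw
    · exact Or.inr hw
  · rw [← mk_image_eq (f := (Subtype.val : X → V)) Subtype.val_injective]
    refine (mk_le_mk_of_subset ?_).trans_lt
      (mk_union_lt hκ h1 (mk_union_lt hκ (h2 u) (h2 v)))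
    have h3 : ∀ a b c : V, D.Adj c a → ¬ D.Adj c b → c = b ∨ c ∈ outNbhd D b \ outNbhd D a := by
      intro a b c hca hcb
      by_cases hc : c = b
      · exact Or.inl hc
      · exact Or.inr ⟨hD.adj_of_not hc hcb, hD.asymm hca⟩
    rintro _ ⟨w, hw | hw, rfl⟩
    · rcases h3 u v w hw.1 hw.2 with h | h
      · exact Or.inr (Or.inr h)
      · exact Or.inl (Or.inr h)
    · rcases h3 v u w hw.1 hw.2 with h | h
      · exact Or.inr (Or.inl h)
      · exact Or.inl (Or.inl h)

/-- All arcs leading to a larger class can be reversed, because there are `κ` paths of length two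
from each vertex to each vertex of a smaller class. -/
theorem exists_achieves_descending {V : Type u} {κ : Cardinal.{u}} (hκ : ℵ₀ ≤ κ) (hV : #V = κ)
    {D : Digraph V} (hD : IsTournament D) {L : Type u} [LinearOrder L] {cls : V → L}
    (hcls : ∀ u v, #(outNbhd D u \ outNbhd D v : Set V) < κ → cls u ≤ cls v) :
    ∃ f, Achieves D (fun _ _ => True) f ∧
      (∀ u v, (swapBy D f).Adj u v → cls v ≤ cls u) ∧
      ∀ u v, cls u = cls v → ((swapBy D f).Adj u v ↔ D.Adj u v) := by
  let F : Set (V × V) := {p | D.Adj p.1 p.2 ∧ cls p.1 < cls p.2}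
  have hFD : ∀ p ∈ F, D.Adj p.1 p.2 := fun p hp => hp.1
  obtain ⟨e, he, heκ⟩ := exists_key_of_mk_le (F := F) hκ
    ((mk_set_le F).trans (by rw [← mul_def]; exact mul_le_of_le hκ hV.le hV.le))
  let S : F → Set (Finset V) := fun p =>
    (fun z => {z}) '' {z | D.Adj p.1.2 z ∧ D.Adj z p.1.1}
  have hS : ∀ p, κ ≤ #(S p) := by
    intro p
    rw [show #(S p) = #{z | D.Adj p.1.2 z ∧ D.Adj z p.1.1} from
      mk_image_eq Finset.singleton_injective]
    have h1 : κ ≤ #(outNbhd D p.1.2 \ outNbhd D p.1.1 : Set V) := by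
      by_contra! hlt
      exact (hcls _ _ hlt).not_gt p.2.2
    refine h1.trans (mk_le_mk_of_subset fun z hz => ⟨hz.1, hD.adj_of_not ?_ hz.2⟩)
    rintro h
    exact hD.asymm p.2.1 (h ▸ hz.1)
  have key := achieves_pairsInd hD hFD isFlipping_isTwoPath he (S := S) ?_
    (fun p => hκ.trans (hS p)) (fun x => (heκ x).trans_le (hS x.1)) ?_
  · refine ⟨_, key, fun u v huv => ?_, fun u v huv => ?_⟩
    · rcases (swapBy_pairsInd_adj hD hFD u v).1 huv with h | h
      · exact not_lt.1 fun hlt => h.2 ⟨h.1, hlt⟩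
      · exact h.2.le
    · refine swapBy_adj_zero (by_contra fun h => ?_)
      rcases pairsInd_ne_zero.1 h with h | h
      · exact h.2.ne huv
      · exact h.2.ne huv.symm
  · rintro p _ ⟨x, -, rfl⟩ _ ⟨y, -, rfl⟩ hne
    exact Finset.disjoint_singleton.2 fun h => hne (by rw [h])
  · rintro p _ ⟨x, hx, rfl⟩
    exact ⟨x, rfl, hx⟩

theorem induced_swapBy_of_eq_zero {V : Type u} {D : Digraph V} {X : Set V}
    {f : V → V → ZMod 2} (h : ∀ a b : X, f a b = 0) : induced (swapBy D f) X = induced D X := by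
  ext a b
  exact swapBy_adj_zero (h a b)

/-- Strong sets become small even in tournaments that are not uniform: once no arc leads to a larger
class, strong sets lie in one class, and the reversal sequences for the classes, which touch
disjoint sets of pairs, can be carried out one after the other. -/
theorem exists_achieves_isStrong_lt {V : Type u} {κ : Cardinal.{u}} (hκ : ℵ₀ ≤ κ) (hV : #V = κ)
    {D : Digraph V} (hD : IsTournament D) :
    ∃ f, Achieves D (fun _ _ => True) f ∧
      ∀ S, IsStrong (induced (swapBy D f) S) → #S < κ := by
  classical
  obtain ⟨L, _, cls, hcls, hcls'⟩ := exists_linear_classes hκ D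
  obtain ⟨f₀, hf₀, hdesc, hsame⟩ := exists_achieves_descending hκ hV hD hcls
  have hE := hD.swapBy hf₀.symm
  have hEadd : ∀ g, swapBy (swapBy D f₀) g = swapBy D (f₀ + g) := fun g =>
    swapBy_swapBy D hf₀.symm
  generalize hEdef : swapBy D f₀ = E at hE hEadd hdesc hsame
  let X : L → Set V := fun l => {v | cls v = l}
  have hclass : ∀ l, ∃ f : X l → X l → ZMod 2, Achieves (induced E (X l)) (fun _ _ => True) f ∧
      ∀ S, IsStrong (induced (swapBy (induced E (X l)) f) S) → #S < κ := by
    intro l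
    -- a class of size less than `κ` can be left alone; the others induce uniform tournaments
    rcases ((mk_set_le (X l)).trans hV.le).lt_or_eq with hlt | heq
    · exact ⟨0, achieves_zero _ _, fun S _ => (mk_set_le S).trans_lt hlt⟩
    · have hind : induced E (X l) = induced D (X l) := by
        ext a b
        exact hsame a b (a.2.trans b.2.symm)
      have hu : IsUniform κ (induced E (X l)) := by
        rw [hind]
        exact isUniform_induced hκ hD fun u hu v hv => hcls' u v (hu.trans hv.symm)
      obtain ⟨f, hf, P, hP⟩ := exists_isGood_of_isUniform hκ heq (hE.induced (X l)) hu
      exact ⟨f, hf, fun S hS => hP.mk_lt_of_isStrong hκ hS⟩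
  choose f hf hfS using hclass
  have hzero : ∀ l k a b, a ∈ X l → k ≠ l → extendPairs (X k) (f k) a b = 0 := fun l k a b ha hkl =>
    extendPairs_of_not _ fun h => hkl (h.1.symm.trans ha)
  have key := Achieves.concat (D := E) (WellOrderingRel (α := L))
    (T := fun l a b => a ∈ X l ∧ b ∈ X l) (f := fun l => extendPairs (X l) (f l)) ?_ ?_
  rotate_left
  · intro l
    refine Achieves.of_induced (T := fun _ _ => True) ?_
    convert hf l using 1
    refine induced_swapBy_of_eq_zero fun a b => ?_
    refine finsum_eq_zero_of_forall_eq_zero fun k => ?_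
    split_ifs with hk
    · exact hzero l k a b a.2 fun h => irrefl_of WellOrderingRel l (h ▸ hk)
    · rfl
  · exact fun a b => (Set.finite_singleton (cls a)).subset fun l hl => hl.1.symm
  set g : V → V → ZMod 2 := fun a b => ∑ᶠ l, extendPairs (X l) (f l) a b with hg
  have hgX : ∀ l a b, a ∈ X l → g a b = extendPairs (X l) (f l) a b := fun l a b ha =>
    finsum_eq_single _ l fun k hk => hzero l k a b ha hk
  have hdesc' : ∀ u v, (swapBy E g).Adj u v → cls v ≤ cls u := by
    intro u v huv
    by_cases h : cls v = cls u
    · exact h.le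
    · refine hdesc u v ((swapBy_adj_zero ?_).1 huv)
      rw [hgX (cls u) u v rfl]
      exact extendPairs_of_not _ fun h' => h h'.2
  refine ⟨f₀ + g, (hf₀.trans (hEdef ▸ key)).mono fun _ _ _ => trivial, fun S hS => ?_⟩
  rw [← hEadd] at hS
  rcases S.eq_empty_or_nonempty with rfl | ⟨s, hs⟩
  · simpa using aleph0_pos.trans_le hκ
  have hpath : ∀ a b : S, Relation.TransGen (induced (swapBy E g) S).Adj a b →
      cls b ≤ cls a := by
    intro a b hab
    induction hab with
    | single h => exact hdesc' _ _ h
    | tail _ h ih => exact (hdesc' _ _ h).trans ih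
  have hSX : ∀ t ∈ S, t ∈ X (cls s) := by
    intro t ht
    by_cases hst : s = t
    · exact hst ▸ rfl
    · have hne : (⟨s, hs⟩ : S) ≠ ⟨t, ht⟩ := fun h => hst (congrArg Subtype.val h)
      exact le_antisymm (hpath _ _ (hS _ _ hne)) (hpath _ _ (hS _ _ hne.symm))
  have hind : induced (swapBy E g) (X (cls s)) = swapBy (induced E (X (cls s))) (f (cls s)) := by
    rw [← induced_swapBy_extendPairs]
    ext a b
    exact swapBy_adj_congr (hgX _ a b a.2)
  let ι : S → (Subtype.val ⁻¹' S : Set (X (cls s))) := fun t => ⟨⟨t, hSX t t.2⟩, t.2⟩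
  have hι : Function.Injective ι := fun t t' h =>
    Subtype.ext (congrArg (fun x => (x.1 : V)) h)
  refine (mk_le_of_injective hι).trans_lt (hfS (cls s) _ ?_)
  rw [← hind]
  intro a b hab
  have h1 := hS ⟨a.1.1, a.2⟩ ⟨b.1.1, b.2⟩ fun h =>
    hab (Subtype.ext (Subtype.ext (congrArg (fun x => (x.1 : V)) h)))
  exact Relation.TransGen.lift
    (p := (induced (induced (swapBy E g) (X (cls s))) (Subtype.val ⁻¹' S)).Adj) ι
    (fun _ _ h => h) _ _ h1

end CycleReversal

theorem mainTheorem5 {V : Type u} (κ : Cardinal.{u}) (hκ : ℵ₀ ≤ κ) (hV : #V = κ)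
    (D : Digraph V) (hD : IsTournament D) :
    (IsUniform κ D → ∃ C ∈ rs D, ∃ Vp Vm : Set V, Vp ∪ Vm = Set.univ ∧
      (∀ v, #(inNbhd (induced (rev D C) Vp) v) < κ) ∧
      (∀ v, #(outNbhd (induced (rev D C) Vm) v) < κ) ∧
      ∀ S, IsStrongComponent (rev D C) S → S ⊆ Vp ∨ S ⊆ Vm) ∧
    (IsUniform κ D → ∃ C ∈ rs D, ∀ S, IsStrongComponent (rev D C) S → #S < κ) ∧
    (∃ C ∈ rs D, ∀ S, IsStrongComponent (rev D C) S → #S < κ) := by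
  have hC : ∃ C ∈ rs D, ∀ S, IsStrongComponent (rev D C) S → #S < κ := by
    obtain ⟨f, hf, hS⟩ := exists_achieves_isStrong_lt hκ hV hD
    obtain ⟨C, hC, hrev⟩ := hf.exists_mem_rs hD
    exact ⟨C, hC, fun S h => hS S (hrev ▸ h.prop)⟩
  refine ⟨fun hu => ?_, fun _ => hC, hC⟩
  obtain ⟨f, hf, P, hP⟩ := exists_isGood_of_isUniform hκ hV hD hu
  obtain ⟨C, hC, hrev⟩ := hf.exists_mem_rs hD
  rw [← hrev] at hP
  refine ⟨C, hC, P, Pᶜ, Set.union_compl_self P, fun v => ?_, fun v => ?_,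
    fun S hS => hP.subset_or_subset hS.prop⟩
  · obtain ⟨S, hvS, hSκ, hcl⟩ := hP.inside v v.2
    rw [← mk_image_eq (f := (Subtype.val : P → V)) Subtype.val_injective]
    refine (mk_le_mk_of_subset ?_).trans_lt hSκ
    rintro _ ⟨w, hw, rfl⟩
    exact hcl w w.2 v hvS hw
  · obtain ⟨S, hvS, hSκ, hcl⟩ := hP.outside v v.2
    rw [← mk_image_eq (f := (Subtype.val : (Pᶜ : Set V) → V)) Subtype.val_injective]
    refine (mk_le_mk_of_subset ?_).trans_lt hSκ
    rintro _ ⟨w, hw, rfl⟩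
    exact hcl w w.2 v hvS hw
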